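/- Let $\mathcal E$ be a finite-dimensional real vector space with inner product $\langle\cdot,\cdot\rangle$ and a norm $\|\cdot\|$ (not necessarily induced by the inner product), with dual norm $\|\zeta\|_*=\sup\{\langle\zeta,x\rangle:\|x\|\le1\}$, and let $Z\subset\mathcal E$ be nonempty, closed and convex. Let - $G$ be a real function, continuously differentiable on $Z$, with $0\le G(w)-G(v)-\langle\nabla G(v),w-v\rangle\le\frac{L_G}{2}\|w-v\|^2$ for all $w,v\in Z$, where $L_G\ge0$; - $H:Z\to\mathcal E$ be monotone and Lipschitz: $\langle H(w)-H(v),w-v\rangle\ge0$ and $\|H(w)-H(v)\|_*\le L_H\|w-v\|$ for all $w,v\in Z$, where $L_H\ge0$; - $J:Z\to\mathbb R$ be convex and lower semicontinuous; - $\omega$ be a real function, differentiable at every point of $Z$ and strongly convex on $Z$ with parameter $\mu>0$ with respect to $\|\cdot\|$. Put $V(z,u)=\omega(u)-\omega(z)-\langle\nabla\omega(z),u-z\rangle$ and, for $z\in Z$, $\eta\in\mathcal E$ and $\gamma>0$, $$P_z^{\gamma J}(\eta)=\operatorname*{argmin}_{u\in Z}\ \langle\eta,u-z\rangle+V(z,u)+\gamma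 J(u).$$ Assume $V(z_1,z_2)\le\Omega_Z^2$ for all $z_1,z_2\in Z$, where $\Omega_Z\ge0$. For $\tilde u\in Z$ let $$g(\tilde u)=\sup_{u\in Z}\big[G(\tilde u)-G(u)+\langle H(u),\tilde u-u\rangle+J(\tilde u)-J(u)\big].$$ Let $\xi_1,\xi_2,\dots,\zeta_1,\zeta_2,\dots$ be jointly independent random variables with values in a measurable space $\Xi$, and let $\mathcal G,\mathcal H:\mathcal E\times\Xi\to\mathcal E$ be measurable maps (the stochastic oracles, queried only at points of $Z$) with $\mathbb E[\mathcal G(x,\xi_i)]=\nabla G(x)$ and $\mathbb E[\mathcal H(x,\zeta_i)]=H(x)$ for all $x\in Z$, $i\ge1$. Let $\sigma_G,\sigma_H\ge0$. Stochastic accelerated mirror-prox method: choose a (deterministic) $r_1\in Z$, set $w_1=w_1^{ag}=r_1$, and for $t=1,2,\dots$ let $$\begin{aligned}w_t^{md}&=(1-\alpha_t)w_t^{ag}+\alpha_tr_t,\\ w_{t+1}&=P_{r_t}^{\gamma_tJ}\big(\gamma_t\mathcal H(r_t,\zeta_{2t-1})+\gamma_t\mathcal G(w_t^{md},\xi_t)\big),\\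 r_{t+1}&=P_{r_t}^{\gamma_tJ}\big(\gamma_t\mathcal H(w_{t+1},\zeta_{2t})+\gamma_t\mathcal G(w_t^{md},\xi_t)\big),\\ w_{t+1}^{ag}&=(1-\alpha_t)w_t^{ag}+\alpha_tw_{t+1}.\end{aligned}$$ Let $\Gamma_1=1$ and $\Gamma_t=(1-\alpha_t)\Gamma_{t-1}$ for $t>1$. Assume $\alpha_1=1$, $0\le\alpha_t<1$ for $t>1$, $\gamma_t>0$ for $t\ge1$, and that for some $q\in(0,1)$ and all $t\ge1$ $$q\mu-L_G\alpha_t\gamma_t-\frac{3L_H^2\gamma_t^2}{\mu}\ge0,\qquad \frac{\alpha_t}{\Gamma_t\gamma_t}\le\frac{\alpha_{t+1}}{\Gamma_{t+1}\gamma_{t+1}}.$$ Put $$R(t)=\Big[4\sigma_H^2+\Big(1+\frac1{2(1-q)}\Big)\sigma_G^2\Big]\Gamma_t\sum_{i=1}^t\frac{\alpha_i\gamma_i}{\mu\Gamma_i},\qquad \mathcal Q_0(t)=\frac{2\alpha_t}{\gamma_t}\Omega_Z^2+R(t),$$ $$\mathcal Q_1(t)=\Gamma_t(\sigma_G+\sigma_H)\,\Omega_Z\sqrt{\frac2\mu\sum_{i=1}^t\Big(\frac{\alpha_i}{\Gamma_i}\Big)^2}+R(t).$$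 Then $g$ is finite on $Z$, and: (a) If $\mathbb E\|\mathcal G(x,\xi_i)-\nabla G(x)\|_*^2\le\sigma_G^2$ and $\mathbb E\|\mathcal H(x,\zeta_i)-H(x)\|_*^2\le\sigma_H^2$ for all $x\in Z$ and $i\ge1$, then for all $t\ge1$ the random variable $g(w_{t+1}^{ag})$ is integrable and $\mathbb E[g(w_{t+1}^{ag})]\le\mathcal Q_0(t)$. (b) If $\mathbb E\exp\{\|\nabla G(x)-\mathcal G(x,\xi_i)\|_*^2/\sigma_G^2\}\le e$ and $\mathbb E\exp\{\|H(x)-\mathcal H(x,\zeta_i)\|_*^2/\sigma_H^2\}\le e$ for all $x\in Z$ and $i\ge1$ (where for $\sigma_G=0$ or $\sigma_H=0$ the condition means that the respective oracle output is almost surely exact), then for all $\lambda>0$ and $t\ge1$ $$\Pr\{g(w_{t+1}^{ag})>\mathcal Q_0(t)+\lambda\mathcal Q_1(t)\}\le2e^{-\lambda^2/3}+3e^{-\lambda}.$$ -/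

import Mathlib

open MeasureTheory ProbabilityTheory Finset
open scoped Gradient RealInnerProductSpace

namespace StochAMP

noncomputable section

/-- The dual norm `‖ζ‖_* = sup {⟨ζ, x⟩ : ‖x‖ ≤ 1}` of a norm `N` (which need not be the norm
induced by the inner product). -/
def dualNorm {E : Type*} [NormedAddCommGroup E] [InnerProductSpace ℝ E]
    (N : Seminorm ℝ E) (ζ : E) : ℝ :=
  sSup ((fun x : E => ⟪ζ, x⟫) '' {x : E | N x ≤ 1})

/-- `f` is strongly convex on `Z` with parameter `μ` with respect to the norm `N`. -/
def StronglyConvexOn {E : Type*} [NormedAddCommGroup E] [InnerProductSpace ℝ E]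
    (N : Seminorm ℝ E) (μ : ℝ) (Z : Set E) (f : E → ℝ) : Prop :=
  ∀ x ∈ Z, ∀ y ∈ Z, ∀ a b : ℝ, 0 ≤ a → 0 ≤ b → a + b = 1 →
    f (a • x + b • y) ≤ a * f x + b * f y - a * b * (μ / 2 * N (x - y) ^ 2)

/-- The prox-function (Bregman divergence) `V(z, u) = ω(u) - ω(z) - ⟨∇ω(z), u - z⟩`. -/
def bregman {E : Type*} [NormedAddCommGroup E] [InnerProductSpace ℝ E] [CompleteSpace E]
    (ω : E → ℝ) (z u : E) : ℝ :=
  ω u - ω z - ⟪∇ ω z, u - z⟫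

/-- `x = P_z^J(η)`, that is, `x` minimizes `⟨η, u - z⟩ + V(z, u) + J(u)` over `u ∈ Z`. -/
def IsProx {E : Type*} [NormedAddCommGroup E] [InnerProductSpace ℝ E] [CompleteSpace E]
    (Z : Set E) (ω J : E → ℝ) (z η x : E) : Prop :=
  x ∈ Z ∧ ∀ u ∈ Z, ⟪η, x - z⟫ + bregman ω z x + J x ≤ ⟪η, u - z⟫ + bregman ω z u + J u

/-- `Q(x, u) = G(x) - G(u) + ⟨H(u), x - u⟩ + J(x) - J(u)`. -/
def gapQ {E : Type*} [NormedAddCommGroup E] [InnerProductSpace ℝ E]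
    (G : E → ℝ) (H : E → E) (J : E → ℝ) (x u : E) : ℝ :=
  G x - G u + ⟪H u, x - u⟫ + J x - J u

/-- The gap function `g(x) = sup_{u ∈ Z} Q(x, u)`. -/
def gap {E : Type*} [NormedAddCommGroup E] [InnerProductSpace ℝ E]
    (Z : Set E) (G : E → ℝ) (H : E → E) (J : E → ℝ) (x : E) : ℝ :=
  sSup (gapQ G H J x '' Z)

/-- `Γ_1 = 1` and `Γ_t = (1 - α_t) Γ_{t-1}` for `t > 1` (the value at index `0` is unused). -/
def Gam (α : ℕ → ℝ) : ℕ → ℝ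
  | 0 => 1
  | 1 => 1
  | (t + 2) => (1 - α (t + 2)) * Gam α (t + 1)

/-- One run of the stochastic accelerated mirror-prox method from the starting point `r₁`, with
oracles `𝒢`, `ℋ` and samples `ξ_1, ξ_2, …` and `ζ_1, ζ_2, …`. All sequences are indexed from `1`;
`wag` and `wmd` are the aggregated and the middle sequence. -/
structure IsRun {E Ξ : Type*} [NormedAddCommGroup E] [InnerProductSpace ℝ E] [CompleteSpace E]
    (Z : Set E) (ω J : E → ℝ) (𝒢 ℋ : E → Ξ → E) (α γ : ℕ → ℝ) (r₁ : E) (ξ ζ : ℕ → Ξ)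
    (r w wag wmd : ℕ → E) : Prop where
  r_one : r 1 = r₁
  w_one : w 1 = r₁
  wag_one : wag 1 = r₁
  wmd_eq : ∀ t, 1 ≤ t → wmd t = (1 - α t) • wag t + α t • r t
  w_succ : ∀ t, 1 ≤ t → IsProx Z ω (fun u => γ t * J u) (r t)
    (γ t • ℋ (r t) (ζ (2 * t - 1)) + γ t • 𝒢 (wmd t) (ξ t)) (w (t + 1))
  r_succ : ∀ t, 1 ≤ t → IsProx Z ω (fun u => γ t * J u) (r t)
    (γ t • ℋ (w (t + 1)) (ζ (2 * t)) + γ t • 𝒢 (wmd t) (ξ t)) (r (t + 1))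
  wag_succ : ∀ t, 1 ≤ t → wag (t + 1) = (1 - α t) • wag t + α t • w (t + 1)

/-- The calls `A(x, s_i)`, `i ≥ 1`, are unbiased estimates of the operator `F` at each `x ∈ Z`. -/
def Unbiased {Ω Ξ E : Type*} [MeasurableSpace Ω] [NormedAddCommGroup E] [InnerProductSpace ℝ E]
    (P : Measure Ω) (Z : Set E) (A : E → Ξ → E) (F : E → E) (s : ℕ → Ω → Ξ) : Prop :=
  ∀ i, 1 ≤ i → ∀ x ∈ Z,
    Integrable (fun o => A x (s i o)) P ∧ ∫ o, A x (s i o) ∂P = F x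

/-- `𝔼 ‖A(x, s_i) - F(x)‖_*² ≤ σ²` for all `x ∈ Z` and all `i ≥ 1`. -/
def VarianceBound {Ω Ξ E : Type*} [MeasurableSpace Ω] [NormedAddCommGroup E]
    [InnerProductSpace ℝ E] (P : Measure Ω) (N : Seminorm ℝ E) (Z : Set E)
    (A : E → Ξ → E) (F : E → E) (s : ℕ → Ω → Ξ) (σ : ℝ) : Prop :=
  ∀ i, 1 ≤ i → ∀ x ∈ Z,
    Integrable (fun o => dualNorm N (A x (s i o) - F x) ^ 2) P ∧
      ∫ o, dualNorm N (A x (s i o) - F x) ^ 2 ∂P ≤ σ ^ 2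

/-- `𝔼 exp (‖F(x) - A(x, s_i)‖_*² / σ²) ≤ exp 1` for all `x ∈ Z` and all `i ≥ 1`; for `σ = 0` this
is read with `0 / 0 = 0` and `c / 0 = ∞` for `c > 0`, that is, the oracle is almost surely exact. -/
def LightTail {Ω Ξ E : Type*} [MeasurableSpace Ω] [NormedAddCommGroup E]
    [InnerProductSpace ℝ E] (P : Measure Ω) (N : Seminorm ℝ E) (Z : Set E)
    (A : E → Ξ → E) (F : E → E) (s : ℕ → Ω → Ξ) (σ : ℝ) : Prop :=
  ∀ i, 1 ≤ i → ∀ x ∈ Z,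
    (σ = 0 → ∀ᵐ o ∂P, A x (s i o) = F x) ∧
    (σ ≠ 0 →
      Integrable (fun o => Real.exp (dualNorm N (F x - A x (s i o)) ^ 2 / σ ^ 2)) P ∧
        ∫ o, Real.exp (dualNorm N (F x - A x (s i o)) ^ 2 / σ ^ 2) ∂P ≤ Real.exp 1)

/-- The term `[4 σ_H² + (1 + 1 / (2 (1 - q))) σ_G²] Γ_t ∑_{i=1}^t α_i γ_i / (μ Γ_i)`. -/
def noiseTerm (μ q σG σH : ℝ) (α γ : ℕ → ℝ) (t : ℕ) : ℝ :=
  (4 * σH ^ 2 + (1 + 1 / (2 * (1 - q))) * σG ^ 2) * Gam α t *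
    ∑ i ∈ Finset.Icc 1 t, α i * γ i / (μ * Gam α i)

/-- `𝒬_0(t)`. -/
def Q0 (μ q σG σH ΩZ : ℝ) (α γ : ℕ → ℝ) (t : ℕ) : ℝ :=
  2 * α t / γ t * ΩZ ^ 2 + noiseTerm μ q σG σH α γ t

/-- `𝒬_1(t)`. -/
def Q1 (μ q σG σH ΩZ : ℝ) (α γ : ℕ → ℝ) (t : ℕ) : ℝ :=
  Gam α t * (σG + σH) * ΩZ * Real.sqrt (2 / μ * ∑ i ∈ Finset.Icc 1 t, (α i / Gam α i) ^ 2) +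
    noiseTerm μ q σG σH α γ t

end

end StochAMP

/-! Fix a competitor u in Z. Convexity and smoothness of G, monotonicity of H and convexity of J
bound Q(w_{t+1}^{ag}, u) by (1 - α_t) Q(w_t^{ag}, u), plus α_t times a linearised gap at w_{t+1},
plus a quadratic term (`Data.gapQ_step`). The two prox steps turn the linearised gap into a
difference of Bregman divergences plus oracle errors (`Data.prox_step`). The term -V(r_t, w_{t+1}) ≤
-(μ/2)‖w_{t+1} - r_t‖² is a budget: its share q pays for L_G and L_H, its share 1 - q for part of
the error of 𝒢 (`Data.iteration`).

The obstacle is that g is a supremum over u, so the errors are paired with a point that may depend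
on the whole run and do not average out. A second prox sequence v_t, driven by the errors alone,
makes the pairings with u - v_t telescope against another Bregman divergence (`Data.aux_step`);
hence the factor 2 before Ω_Z². What remains is paired with v_t - w_{t+1} (second call of ℋ) and v_t
- r_t (call of 𝒢), both known before the respective sample is drawn. Dividing by Γ_t and summing
gives a pathwise bound of the gap by squared errors and two martingale sums (`Data.gap_run_le`).

For (a), the martingale sums have mean zero. For (b), a union bound over five sums: the three sums
of squares have exponential tails by Jensen (`measureReal_weighted_sum_lt_le`), the two martingale
sums have Gaussian tails (`measureReal_sum_lt_le`), fed by the moment bound exp(3θ²/4) of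
`integral_exp_mul_le_of_centered`.

Measurability of the iterates is not free, since ∇ω need not be measurable: `measurable_of_isProx`
shows that the prox-mapping only sees the component of ∇ω along Z, which is. -/

namespace StochAMP

/-! ### The dual norm and equivalence of norms in finite dimension. -/

section Norms

variable {E : Type*} [NormedAddCommGroup E] [InnerProductSpace ℝ E] {N : Seminorm ℝ E}

theorem dualNorm_le {ζ : E} {C : ℝ} (hC : ∀ x, N x ≤ 1 → ⟪ζ, x⟫ ≤ C) : dualNorm N ζ ≤ C := by
  refine csSup_le ⟨_, 0, by simp, rfl⟩ ?_
  rintro _ ⟨x, hx, rfl⟩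
  exact hC x hx

theorem dualNorm_neg (ζ : E) : dualNorm N (-ζ) = dualNorm N ζ := by
  unfold dualNorm
  congr 1
  ext y
  constructor <;> rintro ⟨x, hx, rfl⟩ <;> exact ⟨-x, by simpa using hx, by simp⟩

theorem dualNorm_sub_rev (ζ η : E) : dualNorm N (ζ - η) = dualNorm N (η - ζ) := by
  rw [← dualNorm_neg, neg_sub]

variable [FiniteDimensional ℝ E]

theorem continuous_seminorm (N : Seminorm ℝ E) : Continuous N :=
  (N.convexOn.locallyLipschitz).continuous

theorem exists_seminorm_le (N : Seminorm ℝ E) : ∃ C : ℝ, 0 < C ∧ ∀ x, N x ≤ C * ‖x‖ :=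
  Seminorm.bound_of_continuous_normedSpace N (continuous_seminorm N)

theorem exists_le_seminorm (hN : ∀ x, N x = 0 → x = 0) :
    ∃ c : ℝ, 0 < c ∧ ∀ x, c * ‖x‖ ≤ N x := by
  rcases subsingleton_or_nontrivial E with h | h
  · exact ⟨1, one_pos, fun x => by simp [Subsingleton.elim x 0]⟩
  obtain ⟨y, hy, hmin⟩ := (isCompact_sphere (0 : E) 1).exists_isMinOn
    (NormedSpace.sphere_nonempty.2 zero_le_one) (continuous_seminorm N).continuousOn
  have hy1 : ‖y‖ = 1 := by simpa using hy
  have hy0 : 0 < N y := by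
    refine lt_of_le_of_ne (apply_nonneg N y) fun h0 => ?_
    rw [hN y h0.symm, norm_zero] at hy1
    exact zero_ne_one hy1
  refine ⟨N y, hy0, fun x => ?_⟩
  rcases eq_or_ne x 0 with rfl | hx
  · simp
  have hx' : 0 < ‖x‖ := norm_pos_iff.2 hx
  have h1 : N y ≤ N (‖x‖⁻¹ • x) := by
    refine isMinOn_iff.1 hmin _ ?_
    simp [norm_smul, hx'.ne']
  rw [map_smul_eq_mul, norm_inv, norm_norm, inv_mul_eq_div, le_div_iff₀ hx'] at h1
  exact h1

theorem bddAbove_inner_image (hN : ∀ x, N x = 0 → x = 0) (ζ : E) :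
    BddAbove ((fun x : E => ⟪ζ, x⟫) '' {x : E | N x ≤ 1}) := by
  obtain ⟨c, hc, h⟩ := exists_le_seminorm hN
  refine ⟨‖ζ‖ * c⁻¹, ?_⟩
  rintro _ ⟨x, hx, rfl⟩
  refine (real_inner_le_norm ζ x).trans (mul_le_mul_of_nonneg_left ?_ (norm_nonneg _))
  rw [← one_div, le_div_iff₀ hc, mul_comm]
  exact (h x).trans hx

theorem inner_le_dualNorm (hN : ∀ x, N x = 0 → x = 0) (ζ x : E) :
    ⟪ζ, x⟫ ≤ dualNorm N ζ * N x := by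
  rcases eq_or_ne (N x) 0 with h0 | h0
  · simp [hN x h0]
  have hpos : 0 < N x := lt_of_le_of_ne (apply_nonneg N x) h0.symm
  have h1 : ⟪ζ, (N x)⁻¹ • x⟫ ≤ dualNorm N ζ := by
    refine le_csSup (bddAbove_inner_image hN ζ) ⟨_, ?_, rfl⟩
    simp only [Set.mem_ofPred_eq, map_smul_eq_mul, norm_inv, Real.norm_eq_abs, abs_of_pos hpos]
    rw [inv_mul_cancel₀ h0]
  rw [real_inner_smul_right, inv_mul_eq_div, div_le_iff₀ hpos] at h1
  exact h1

theorem dualNorm_nonneg (hN : ∀ x, N x = 0 → x = 0) (ζ : E) : 0 ≤ dualNorm N ζ :=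
  le_csSup (bddAbove_inner_image hN ζ) ⟨0, by simp, by simp⟩

theorem dualNorm_add_le (hN : ∀ x, N x = 0 → x = 0) (ζ η : E) :
    dualNorm N (ζ + η) ≤ dualNorm N ζ + dualNorm N η := by
  refine dualNorm_le fun x hx => ?_
  rw [inner_add_left]
  have h1 := inner_le_dualNorm hN ζ x
  have h2 := inner_le_dualNorm hN η x
  nlinarith [dualNorm_nonneg hN ζ, dualNorm_nonneg hN η]

theorem abs_inner_le_dualNorm (hN : ∀ x, N x = 0 → x = 0) (ζ x : E) :
    |⟪ζ, x⟫| ≤ dualNorm N ζ * N x := by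
  refine abs_le'.2 ⟨inner_le_dualNorm hN ζ x, ?_⟩
  have := inner_le_dualNorm hN (-ζ) x
  rwa [inner_neg_left, dualNorm_neg] at this

theorem exists_dualNorm_le (hN : ∀ x, N x = 0 → x = 0) :
    ∃ C : ℝ, 0 ≤ C ∧ ∀ ζ : E, dualNorm N ζ ≤ C * ‖ζ‖ := by
  obtain ⟨c, hc, h⟩ := exists_le_seminorm hN
  refine ⟨c⁻¹, by positivity, fun ζ => dualNorm_le fun x hx => ?_⟩
  refine (real_inner_le_norm ζ x).trans ?_
  rw [mul_comm]
  refine mul_le_mul_of_nonneg_right ?_ (norm_nonneg _)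
  rw [← one_div, le_div_iff₀ hc, mul_comm]
  exact (h x).trans hx

/-- Test the dual norm on ζ itself. -/
theorem exists_norm_le_dualNorm (hN : ∀ x, N x = 0 → x = 0) :
    ∃ C : ℝ, 0 < C ∧ ∀ ζ : E, ‖ζ‖ ≤ C * dualNorm N ζ := by
  obtain ⟨C, hC, h⟩ := exists_seminorm_le N
  refine ⟨C, hC, fun ζ => ?_⟩
  rcases eq_or_ne ζ 0 with rfl | hz
  · simpa using mul_nonneg hC.le (dualNorm_nonneg hN 0)
  have h1 := inner_le_dualNorm hN ζ ζ
  rw [real_inner_self_eq_norm_sq] at h1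
  have h2 := mul_le_mul_of_nonneg_left (h ζ) (dualNorm_nonneg hN ζ)
  have h3 : 0 < ‖ζ‖ := norm_pos_iff.2 hz
  nlinarith

theorem continuous_dualNorm (hN : ∀ x, N x = 0 → x = 0) : Continuous (dualNorm N) := by
  obtain ⟨C, hC, h⟩ := exists_dualNorm_le hN
  refine (LipschitzWith.of_dist_le_mul (K := ⟨C, hC⟩) fun x y => ?_).continuous
  rw [Real.dist_eq, dist_eq_norm]
  refine abs_le'.2 ⟨?_, ?_⟩
  · have := dualNorm_add_le hN (x - y) y
    rw [sub_add_cancel] at this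
    change _ ≤ C * _
    linarith [h (x - y)]
  · have := dualNorm_add_le hN (y - x) x
    rw [sub_add_cancel] at this
    rw [norm_sub_rev]
    change _ ≤ C * _
    linarith [h (y - x)]

theorem continuousOn_of_dualNorm_sub_le (hN : ∀ x, N x = 0 → x = 0) {Z : Set E} {H : E → E} {L : ℝ}
    (hL : 0 ≤ L) (hH : ∀ x ∈ Z, ∀ v ∈ Z, dualNorm N (H x - H v) ≤ L * N (x - v)) :
    ContinuousOn H Z := by
  obtain ⟨C, hC, h⟩ := exists_norm_le_dualNorm hN
  obtain ⟨D, hD, hD'⟩ := exists_seminorm_le N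
  refine LipschitzOnWith.continuousOn (K := ⟨C * (L * D), by positivity⟩)
    (LipschitzOnWith.of_dist_le_mul fun x hx y hy => ?_)
  rw [dist_eq_norm, dist_eq_norm]
  change _ ≤ C * (L * D) * _
  calc ‖H x - H y‖ ≤ C * dualNorm N (H x - H y) := h _
    _ ≤ C * (L * N (x - y)) := by gcongr; exact hH x hx y hy
    _ ≤ C * (L * (D * ‖x - y‖)) := by gcongr; exact hD' _
    _ = _ := by ring

end Norms

/-- Directional derivatives are taken along these points: they stay in Z, and being a sequence they
keep limits of measurable functions measurable. -/
theorem segment_mem {E : Type*} [AddCommGroup E] [Module ℝ E] {Z : Set E}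
    (hZ : Convex ℝ Z) {x y : E} (hx : x ∈ Z) (hy : y ∈ Z) (n : ℕ) :
    x + ((n : ℝ) + 1)⁻¹ • (y - x) ∈ Z := by
  refine hZ.add_smul_sub_mem hx hy ⟨by positivity, ?_⟩
  exact inv_le_one_of_one_le₀ (by linarith [(Nat.cast_nonneg n : (0 : ℝ) ≤ n)])

/-! ### Bregman divergences and the prox-mapping. -/

section Bregman

variable {E : Type*} [NormedAddCommGroup E] [InnerProductSpace ℝ E] [CompleteSpace E]
  {N : Seminorm ℝ E} {Z : Set E} {ω J : E → ℝ} {μ : ℝ}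

/-- The difference quotients along a segment converge to the directional derivative. -/
theorem tendsto_slope_gradient {z : E} (h : DifferentiableAt ℝ ω z) (d : E) :
    Filter.Tendsto (fun n : ℕ => ((n : ℝ) + 1) * (ω (z + ((n : ℝ) + 1)⁻¹ • d) - ω z))
      Filter.atTop (nhds ⟪∇ ω z, d⟫) := by
  have h1 := h.hasGradientAt.hasFDerivAt.hasLineDerivAt d
  have h2 := (hasDerivAt_iff_tendsto_slope.1 h1)
  have h3 : Filter.Tendsto (fun n : ℕ => ((n : ℝ) + 1)⁻¹) Filter.atTop (nhdsWithin 0 {0}ᶜ) := by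
    refine tendsto_nhdsWithin_iff.2 ⟨?_, Filter.Eventually.of_forall fun n => ?_⟩
    · simpa using tendsto_one_div_add_atTop_nhds_zero_nat (𝕜 := ℝ)
    · simp only [Set.mem_compl_iff, Set.mem_singleton_iff, inv_eq_zero]
      positivity
  have h4 := h2.comp h3
  simp only [InnerProductSpace.toDual_apply_apply] at h4
  refine h4.congr fun n => ?_
  simp [slope_def_field, div_inv_eq_mul, mul_comm]

/-- The Bregman divergence of a strongly convex function grows quadratically. -/
theorem le_bregman (hω : StronglyConvexOn N μ Z ω) {z u : E} (hz : z ∈ Z) (hu : u ∈ Z)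
    (hd : DifferentiableAt ℝ ω z) : μ / 2 * N (u - z) ^ 2 ≤ bregman ω z u := by
  have h1 := tendsto_slope_gradient hd (u - z)
  have h2 : Filter.Tendsto (fun n : ℕ => ω u - ω z - (1 - ((n : ℝ) + 1)⁻¹) *
      (μ / 2 * N (u - z) ^ 2)) Filter.atTop
      (nhds (ω u - ω z - (1 - 0) * (μ / 2 * N (u - z) ^ 2))) := by
    have h3 : Filter.Tendsto (fun n : ℕ => ((n : ℝ) + 1)⁻¹) Filter.atTop (nhds 0) := by
      simpa using tendsto_one_div_add_atTop_nhds_zero_nat (𝕜 := ℝ)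
    exact tendsto_const_nhds.sub ((tendsto_const_nhds.sub h3).mul_const _)
  have h4 := le_of_tendsto_of_tendsto' h1 h2 fun n => ?_
  · unfold bregman
    linarith
  have hn : (0 : ℝ) < (n : ℝ) + 1 := by positivity
  set s : ℝ := ((n : ℝ) + 1)⁻¹ with hs
  have hs0 : 0 < s := by positivity
  have hs1 : s ≤ 1 := inv_le_one_of_one_le₀ (by linarith [(Nat.cast_nonneg n : (0 : ℝ) ≤ n)])
  -- Strong convexity at z + s(u - z), to be divided by s; the spare factor 1 - s disappears as s →
  -- 0.
  have h5 := hω u hu z hz s (1 - s) hs0.le (by linarith) (by ring)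
  have h6 : s • u + (1 - s) • z = z + s • (u - z) := by
    rw [smul_sub, sub_smul, one_smul]; abel
  rw [h6] at h5
  have h7 : (n : ℝ) + 1 = s⁻¹ := by rw [hs, inv_inv]
  rw [h7, inv_mul_eq_div, div_le_iff₀ hs0]
  linarith

theorem bregman_nonneg (hμ : 0 < μ) (hω : StronglyConvexOn N μ Z ω) {z u : E} (hz : z ∈ Z)
    (hu : u ∈ Z) (hd : DifferentiableAt ℝ ω z) : 0 ≤ bregman ω z u :=
  le_trans (by positivity) (le_bregman hω hz hu hd)

/-- The variational inequality that characterizes the prox-mapping. -/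
theorem IsProx.variational (hZ : Convex ℝ Z) (hJ : ConvexOn ℝ Z J) {z η x u : E}
    (hx : IsProx Z ω J z η x) (hd : DifferentiableAt ℝ ω x) (hu : u ∈ Z) :
    0 ≤ ⟪η + ∇ ω x - ∇ ω z, u - x⟫ + (J u - J x) := by
  have h1 := (tendsto_slope_gradient hd (u - x)).const_add (⟪η - ∇ ω z, u - x⟫ + (J u - J x))
  have h2 := ge_of_tendsto' h1 (b := 0) fun n => ?_
  · have : ⟪η + ∇ ω x - ∇ ω z, u - x⟫ = ⟪η - ∇ ω z, u - x⟫ + ⟪∇ ω x, u - x⟫ := by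
      rw [← inner_add_left]; congr 1; abel
    linarith
  have hn : (0 : ℝ) < (n : ℝ) + 1 := by positivity
  set s : ℝ := ((n : ℝ) + 1)⁻¹ with hs
  have hs0 : 0 < s := by positivity
  have hs1 : s ≤ 1 := inv_le_one_of_one_le₀ (by linarith [(Nat.cast_nonneg n : (0 : ℝ) ≤ n)])
  -- Compare x with x + s(u - x) and divide by s. Convexity makes the increment of J linear in s, so
  -- only ω has to be differentiable.
  have h3 := hx.2 _ (segment_mem hZ hx.1 hu n)
  rw [← hs] at h3
  have h4 := hJ.2 hx.1 hu (sub_nonneg.2 hs1) hs0.le (by ring)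
  have h6 : (1 - s) • x + s • u = x + s • (u - x) := by
    rw [smul_sub, sub_smul, one_smul]; abel
  rw [h6, smul_eq_mul, smul_eq_mul] at h4
  have h7 : (n : ℝ) + 1 = s⁻¹ := by rw [hs, inv_inv]
  have h8 : ∀ a : E, ⟪a, x + s • (u - x) - z⟫ = ⟪a, x - z⟫ + s * ⟪a, u - x⟫ := fun a => by
    rw [← real_inner_smul_right, ← inner_add_right]; congr 1; abel
  unfold bregman at h3
  rw [h8, h8] at h3
  rw [h7, inv_mul_eq_div, ← neg_le_iff_add_nonneg', le_div_iff₀ hs0, inner_sub_left]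
  linarith

theorem bregman_three_point (z x u : E) :
    bregman ω z u - bregman ω z x - bregman ω x u = ⟪∇ ω x - ∇ ω z, u - x⟫ := by
  unfold bregman
  simp only [inner_sub_left, inner_sub_right]
  ring

/-- The three-point inequality of the prox-mapping. -/
theorem IsProx.three_point (hZ : Convex ℝ Z) (hJ : ConvexOn ℝ Z J) {z η x u : E}
    (hx : IsProx Z ω J z η x) (hd : DifferentiableAt ℝ ω x) (hu : u ∈ Z) :
    J x + ⟪η, x - u⟫ + bregman ω z x + bregman ω x u ≤ bregman ω z u + J u := by
  have h1 := hx.variational hZ hJ hd hu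
  have h2 := bregman_three_point (ω := ω) z x u
  have h3 : ⟪η + ∇ ω x - ∇ ω z, u - x⟫ = -⟪η, x - u⟫ + ⟪∇ ω x - ∇ ω z, u - x⟫ := by
    rw [add_sub_assoc, inner_add_left, ← inner_neg_right, neg_sub]
  linarith

/-- Stability of the prox-mapping. -/
theorem IsProx.stability (hZ : Convex ℝ Z) (hJ : ConvexOn ℝ Z J) (hω : StronglyConvexOn N μ Z ω)
    {z η x z' η' x' : E} (hx : IsProx Z ω J z η x) (hx' : IsProx Z ω J z' η' x')
    (hd : DifferentiableAt ℝ ω x) (hd' : DifferentiableAt ℝ ω x') :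
    μ * N (x - x') ^ 2 ≤ ⟪(η - ∇ ω z) - (η' - ∇ ω z'), x' - x⟫ := by
  -- Adding the two variational inequalities cancels J; the two quadratic lower bounds for ω add up
  -- to strong monotonicity of its gradient.
  have h1 := hx.variational hZ hJ hd hx'.1
  have h2 := hx'.variational hZ hJ hd' hx.1
  have h3 := le_bregman hω hx.1 hx'.1 hd
  have h4 := le_bregman hω hx'.1 hx.1 hd'
  have h5 : N (x' - x) = N (x - x') := map_sub_rev N _ _
  rw [h5] at h3
  unfold bregman at h3 h4
  simp only [inner_sub_left, inner_sub_right, inner_add_left] at *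
  linarith

end Bregman

theorem sq_add_add_le (a b c : ℝ) : (a + b + c) ^ 2 ≤ 3 * (a ^ 2 + b ^ 2 + c ^ 2) := by
  nlinarith [sq_nonneg (a - b), sq_nonneg (b - c), sq_nonneg (a - c)]

/-- Young's inequality for the pairing of a functional and a vector. -/
theorem inner_le_young {E : Type*} [NormedAddCommGroup E] [InnerProductSpace ℝ E]
    [FiniteDimensional ℝ E] {N : Seminorm ℝ E} (hN : ∀ x, N x = 0 → x = 0) {c : ℝ} (hc : 0 < c)
    (s : ℝ) (ζ x : E) :
    s * ⟪ζ, x⟫ ≤ s ^ 2 / (2 * c) * dualNorm N ζ ^ 2 + c / 2 * N x ^ 2 := by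
  have h1 : s * ⟪ζ, x⟫ ≤ |s| * (dualNorm N ζ * N x) :=
    (le_abs_self _).trans (by rw [abs_mul]; gcongr; exact abs_inner_le_dualNorm hN ζ x)
  have h2 : s ^ 2 / (2 * c) * dualNorm N ζ ^ 2 + c / 2 * N x ^ 2 - |s| * (dualNorm N ζ * N x) =
      (|s| * dualNorm N ζ - c * N x) ^ 2 / (2 * c) := by
    rw [← sq_abs s]
    field_simp
    ring
  have h3 : 0 ≤ (|s| * dualNorm N ζ - c * N x) ^ 2 / (2 * c) := by positivity
  linarith

/-! ### Pathwise analysis of one iteration. -/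

section Deterministic

variable {E : Type*} [NormedAddCommGroup E] [InnerProductSpace ℝ E] [CompleteSpace E]

/-- The standing assumptions on the problem data and the step sizes. -/
structure Data (N : Seminorm ℝ E) (Z : Set E) (G : E → ℝ) (LG : ℝ) (H : E → E) (LH : ℝ)
    (J ω : E → ℝ) (μ ΩZ : ℝ) (α γ : ℕ → ℝ) (q : ℝ) : Prop where
  norm_eq_zero : ∀ x, N x = 0 → x = 0
  nonempty : Z.Nonempty
  isClosed : IsClosed Z
  convex : Convex ℝ Z
  LG_nonneg : 0 ≤ LG
  G_diff : ∀ z ∈ Z, DifferentiableAt ℝ G z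
  G_cont : ContinuousOn (∇ G) Z
  G_bound : ∀ x ∈ Z, ∀ v ∈ Z, 0 ≤ G x - G v - ⟪∇ G v, x - v⟫ ∧
    G x - G v - ⟪∇ G v, x - v⟫ ≤ LG / 2 * N (x - v) ^ 2
  LH_nonneg : 0 ≤ LH
  H_mono : ∀ x ∈ Z, ∀ v ∈ Z, 0 ≤ ⟪H x - H v, x - v⟫
  H_lip : ∀ x ∈ Z, ∀ v ∈ Z, dualNorm N (H x - H v) ≤ LH * N (x - v)
  J_convex : ConvexOn ℝ Z J
  J_lsc : LowerSemicontinuousOn J Z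
  μ_pos : 0 < μ
  ω_diff : ∀ z ∈ Z, DifferentiableAt ℝ ω z
  ω_convex : StronglyConvexOn N μ Z ω
  ΩZ_nonneg : 0 ≤ ΩZ
  bregman_le : ∀ z₁ ∈ Z, ∀ z₂ ∈ Z, bregman ω z₁ z₂ ≤ ΩZ ^ 2
  q_pos : 0 < q
  q_lt : q < 1
  α_one : α 1 = 1
  α_mem : ∀ t, 2 ≤ t → 0 ≤ α t ∧ α t < 1
  γ_pos : ∀ t, 1 ≤ t → 0 < γ t
  step : ∀ t, 1 ≤ t → 0 ≤ q * μ - LG * α t * γ t - 3 * LH ^ 2 * γ t ^ 2 / μ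
  mono : ∀ t, 1 ≤ t → α t / (Gam α t * γ t) ≤ α (t + 1) / (Gam α (t + 1) * γ (t + 1))

namespace Data

variable {N : Seminorm ℝ E} {Z : Set E} {G : E → ℝ} {LG : ℝ} {H : E → E} {LH : ℝ}
  {J ω : E → ℝ} {μ ΩZ : ℝ} {α γ : ℕ → ℝ} {q : ℝ}

theorem α_nonneg (D : Data N Z G LG H LH J ω μ ΩZ α γ q) {t : ℕ} (ht : 1 ≤ t) : 0 ≤ α t := by
  rcases ht.eq_or_lt with rfl | h
  · simp [D.α_one]
  · exact (D.α_mem t h).1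

theorem α_le_one (D : Data N Z G LG H LH J ω μ ΩZ α γ q) {t : ℕ} (ht : 1 ≤ t) : α t ≤ 1 := by
  rcases ht.eq_or_lt with rfl | h
  · simp [D.α_one]
  · exact (D.α_mem t h).2.le

theorem Gam_succ {t : ℕ} (ht : 1 ≤ t) : Gam α (t + 1) = (1 - α (t + 1)) * Gam α t := by
  obtain ⟨s, rfl⟩ : ∃ s, t = s + 1 := ⟨t - 1, by omega⟩
  rfl

theorem Gam_pos (D : Data N Z G LG H LH J ω μ ΩZ α γ q) (t : ℕ) : 0 < Gam α t := by
  induction t with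
  | zero => exact one_pos
  | succ n ih =>
    rcases Nat.eq_zero_or_pos n with rfl | h
    · exact one_pos
    · rw [Gam_succ h]
      exact mul_pos (sub_pos.2 (D.α_mem (n + 1) (by omega)).2) ih

theorem le_bregman (D : Data N Z G LG H LH J ω μ ΩZ α γ q) {z u : E} (hz : z ∈ Z) (hu : u ∈ Z) :
    μ / 2 * N (u - z) ^ 2 ≤ bregman ω z u :=
  StochAMP.le_bregman D.ω_convex hz hu (D.ω_diff z hz)

theorem bregman_nonneg (D : Data N Z G LG H LH J ω μ ΩZ α γ q) {z u : E} (hz : z ∈ Z)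
    (hu : u ∈ Z) : 0 ≤ bregman ω z u :=
  StochAMP.bregman_nonneg D.μ_pos D.ω_convex hz hu (D.ω_diff z hz)

theorem seminorm_sub_sq_le (D : Data N Z G LG H LH J ω μ ΩZ α γ q) {z u : E} (hz : z ∈ Z)
    (hu : u ∈ Z) : N (u - z) ^ 2 ≤ 2 / μ * ΩZ ^ 2 := by
  have h1 := (D.le_bregman hz hu).trans (D.bregman_le z hz u hu)
  have h2 := D.μ_pos
  rw [div_mul_eq_mul_div, le_div_iff₀ h2]
  linarith

theorem continuousOn_G (D : Data N Z G LG H LH J ω μ ΩZ α γ q) : ContinuousOn G Z :=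
  fun z hz => (D.G_diff z hz).continuousAt.continuousWithinAt

theorem continuousOn_ω (D : Data N Z G LG H LH J ω μ ΩZ α γ q) : ContinuousOn ω Z :=
  fun z hz => (D.ω_diff z hz).continuousAt.continuousWithinAt

/-- Smoothness is used once, from m to x', where x' - m = a(w - r) yields the factor a². Convexity
of G trades the linear terms at m for the values at x and u, and monotonicity trades H u for H w. -/
theorem gapQ_step (D : Data N Z G LG H LH J ω μ ΩZ α γ q) {a : ℝ} (ha0 : 0 ≤ a) (ha1 : a ≤ 1)
    {r w x u : E} (hr : r ∈ Z) (hw : w ∈ Z) (hx : x ∈ Z) (hu : u ∈ Z) {m x' : E}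
    (hm : m = (1 - a) • x + a • r) (hx' : x' = (1 - a) • x + a • w) :
    gapQ G H J x' u ≤ (1 - a) * gapQ G H J x u + a * (⟪H w + ∇ G m, w - u⟫ + J w - J u) +
      LG * a ^ 2 / 2 * N (w - r) ^ 2 := by
  have hb : 0 ≤ 1 - a := sub_nonneg.2 ha1
  have hmZ : m ∈ Z := hm ▸ D.convex hx hr hb ha0 (by ring)
  have hxZ : x' ∈ Z := hx' ▸ D.convex hx hw hb ha0 (by ring)
  have h1 := (D.G_bound x' hxZ m hmZ).2
  have h2 := mul_nonneg hb (D.G_bound x hx m hmZ).1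
  have h3 := mul_nonneg ha0 (D.G_bound u hu m hmZ).1
  have h4 := mul_nonneg ha0 (D.H_mono w hw u hu)
  have h5 := D.J_convex.2 hx hw hb ha0 (by ring)
  rw [← hx', smul_eq_mul, smul_eq_mul] at h5
  have e1 : N (x' - m) ^ 2 = a ^ 2 * N (w - r) ^ 2 := by
    rw [show x' - m = a • (w - r) by rw [hx', hm, smul_sub]; abel, map_smul_eq_mul, mul_pow,
      Real.norm_eq_abs, sq_abs]
  have e2 : ∀ p y : E, ⟪p, x' - y⟫ = (1 - a) * ⟪p, x - y⟫ + a * ⟪p, w - y⟫ := fun p y => by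
    rw [hx', ← real_inner_smul_right, ← real_inner_smul_right, ← inner_add_right]
    congr 1
    rw [smul_sub, smul_sub, sub_smul, sub_smul, one_smul, one_smul]
    abel
  have e3 : ⟪∇ G m, w - m⟫ = ⟪∇ G m, w - u⟫ + ⟪∇ G m, u - m⟫ := by
    rw [← inner_add_right]; congr 1; abel
  rw [e1, e2, e3] at h1
  unfold gapQ
  rw [e2, inner_add_left]
  rw [inner_sub_left] at h4
  linarith

variable [FiniteDimensional ℝ E]

/-- Boundedness of Z is not assumed: it follows from V ≤ Ω_Z² and the quadratic growth of V. -/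
theorem isCompact (D : Data N Z G LG H LH J ω μ ΩZ α γ q) : IsCompact Z := by
  obtain ⟨c, hc, h⟩ := exists_le_seminorm D.norm_eq_zero
  obtain ⟨z, hz⟩ := D.nonempty
  refine Metric.isCompact_of_isClosed_isBounded D.isClosed
    ((Metric.isBounded_iff_subset_closedBall z).2 ⟨Real.sqrt (2 / μ * ΩZ ^ 2) / c, fun u hu => ?_⟩)
  rw [Metric.mem_closedBall, dist_eq_norm, le_div_iff₀ hc, mul_comm]
  exact (h _).trans (Real.le_sqrt_of_sq_le (D.seminorm_sub_sq_le hz hu))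

theorem continuousOn_H (D : Data N Z G LG H LH J ω μ ΩZ α γ q) : ContinuousOn H Z :=
  continuousOn_of_dualNorm_sub_le D.norm_eq_zero D.LH_nonneg D.H_lip

/-- The prox-mapping without the simple component exists. -/
theorem exists_isProx (D : Data N Z G LG H LH J ω μ ΩZ α γ q) (z η : E) :
    ∃ x, IsProx Z ω (fun _ => 0) z η x := by
  obtain ⟨x, hx, hmin⟩ := D.isCompact.exists_isMinOn D.nonempty
    (f := fun u => ⟪η, u - z⟫ + bregman ω z u) (by
      unfold bregman
      have := D.continuousOn_ω
      fun_prop)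
  exact ⟨x, hx, fun u hu => by simpa using isMinOn_iff.1 hmin u hu⟩

/-- The first three-point inequality is tested at r', the second at u. Their sum leaves g⟨h₂ - h₁, w
- r'⟩, which Young's inequality absorbs into V(w, r'). The factor 3 comes from splitting h₂ - h₁
into the variation of H and the errors of the two calls. -/
theorem prox_step (D : Data N Z G LG H LH J ω μ ΩZ α γ q) {g : ℝ} (hg : 0 < g)
    {r w r' u h₁ h₂ d m : E} (hr : r ∈ Z) (hu : u ∈ Z)
    (hw : IsProx Z ω (fun u => g * J u) r (g • h₁ + g • d) w)
    (hr' : IsProx Z ω (fun u => g * J u) r (g • h₂ + g • d) r') :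
    g * (⟪H w + ∇ G m, w - u⟫ + J w - J u) ≤ bregman ω r u - bregman ω r' u - bregman ω r w +
      3 * g ^ 2 / (2 * μ) * (LH ^ 2 * N (w - r) ^ 2 + dualNorm N (h₂ - H w) ^ 2 +
        dualNorm N (h₁ - H r) ^ 2) - g * (⟪h₂ - H w, w - u⟫ + ⟪d - ∇ G m, w - u⟫) := by
  have hμ := D.μ_pos
  have hJ : ConvexOn ℝ Z (fun u => g * J u) := D.J_convex.smul hg.le
  have h1 := hw.three_point D.convex hJ (D.ω_diff w hw.1) hr'.1
  have h2 := hr'.three_point D.convex hJ (D.ω_diff r' hr'.1) hu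
  have h3 := D.le_bregman hw.1 hr'.1
  have h4 := inner_le_young D.norm_eq_zero hμ g (h₂ - h₁) (w - r')
  rw [map_sub_rev N w r'] at h4
  have h5 : dualNorm N (h₂ - h₁) ^ 2 ≤ 3 * (LH ^ 2 * N (w - r) ^ 2 + dualNorm N (h₂ - H w) ^ 2 +
        dualNorm N (h₁ - H r) ^ 2) := by
    have e : h₂ - h₁ = (H w - H r) + (h₂ - H w) + (H r - h₁) := by abel
    have f1 := dualNorm_add_le D.norm_eq_zero ((H w - H r) + (h₂ - H w)) (H r - h₁)
    have f2 := dualNorm_add_le D.norm_eq_zero (H w - H r) (h₂ - H w)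
    have f3 := D.H_lip w hw.1 r hr
    rw [← e, dualNorm_sub_rev (H r) h₁] at f1
    calc dualNorm N (h₂ - h₁) ^ 2
        ≤ (LH * N (w - r) + dualNorm N (h₂ - H w) + dualNorm N (h₁ - H r)) ^ 2 := by
          refine pow_le_pow_left₀ (dualNorm_nonneg D.norm_eq_zero _) ?_ 2
          linarith
      _ ≤ _ := (sq_add_add_le _ _ _).trans (by rw [mul_pow])
  have h6 : g ^ 2 / (2 * μ) * dualNorm N (h₂ - h₁) ^ 2 ≤
      3 * g ^ 2 / (2 * μ) * (LH ^ 2 * N (w - r) ^ 2 + dualNorm N (h₂ - H w) ^ 2 +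
        dualNorm N (h₁ - H r) ^ 2) :=
    (mul_le_mul_of_nonneg_left h5 (by positivity)).trans (le_of_eq (by ring))
  simp only [inner_add_left, inner_sub_left, inner_sub_right, real_inner_smul_left] at *
  linarith

/-- One step of the auxiliary prox sequence that absorbs the oracle errors. -/
theorem aux_step (D : Data N Z G LG H LH J ω μ ΩZ α γ q) {g : ℝ} {v v' u δ : E}
    (hv : v ∈ Z) (hu : u ∈ Z) (hv' : IsProx Z ω (fun _ => 0) v (-(g • δ)) v') :
    g * ⟪δ, u - v⟫ ≤ bregman ω v u - bregman ω v' u + g ^ 2 / (2 * μ) * dualNorm N δ ^ 2 := by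
  have h1 := hv'.three_point D.convex (convexOn_const 0 D.convex) (D.ω_diff v' hv'.1) hu
  have h2 := D.le_bregman hv hv'.1
  have h3 := inner_le_young D.norm_eq_zero D.μ_pos g δ (v' - v)
  simp only [inner_neg_left, inner_sub_right, real_inner_smul_left] at *
  linarith

/-- The weighted sum of the squared oracle errors of one iteration. -/
noncomputable def sqErr (N : Seminorm ℝ E) (q : ℝ) (δ₁ δ₂ δ : E) : ℝ :=
  5 / 2 * dualNorm N δ₂ ^ 2 + 3 / 2 * dualNorm N δ₁ ^ 2 +
    (1 + 1 / (2 * (1 - q))) * dualNorm N δ ^ 2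

theorem iteration (D : Data N Z G LG H LH J ω μ ΩZ α γ q) {a g : ℝ} (hg : 0 < g)
    (ha0 : 0 ≤ a) (ha1 : a ≤ 1) (hstep : 0 ≤ q * μ - LG * a * g - 3 * LH ^ 2 * g ^ 2 / μ)
    {r w r' u h₁ h₂ d m x x' v v' : E} (hr : r ∈ Z) (hu : u ∈ Z) (hx : x ∈ Z) (hv : v ∈ Z)
    (hw : IsProx Z ω (fun u => g * J u) r (g • h₁ + g • d) w)
    (hr' : IsProx Z ω (fun u => g * J u) r (g • h₂ + g • d) r')
    (hm : m = (1 - a) • x + a • r) (hx' : x' = (1 - a) • x + a • w)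
    (hv' : IsProx Z ω (fun _ => 0) v (-(g • ((h₂ - H w) + (d - ∇ G m)))) v') :
    gapQ G H J x' u ≤ (1 - a) * gapQ G H J x u +
      a / g * (bregman ω r u - bregman ω r' u + (bregman ω v u - bregman ω v' u)) +
      a * g / μ * sqErr N q (h₁ - H r) (h₂ - H w) (d - ∇ G m) +
      a * (⟪h₂ - H w, v - w⟫ + ⟪d - ∇ G m, v - r⟫) := by
  have hμ := D.μ_pos
  have hq := D.q_lt
  have h1 := D.gapQ_step ha0 ha1 hr hw.1 hx hu hm hx'
  have h2 := D.prox_step (m := m) hg hr hu hw hr'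
  have h3 := D.aux_step hv hu hv'
  have h4 := D.le_bregman hr hw.1
  have h5 : dualNorm N ((h₂ - H w) + (d - ∇ G m)) ^ 2 ≤
      2 * (dualNorm N (h₂ - H w) ^ 2 + dualNorm N (d - ∇ G m) ^ 2) :=
    (pow_le_pow_left₀ (dualNorm_nonneg D.norm_eq_zero _)
      (dualNorm_add_le D.norm_eq_zero _ _) 2).trans add_sq_le
  -- The constant is the share of μ that the step-size condition leaves unused.
  have h6 := inner_le_young D.norm_eq_zero (c := (1 - q) * μ) (by nlinarith) (-g) (d - ∇ G m)
    (w - r)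
  have h7 : 0 ≤ (q * μ - LG * a * g - 3 * LH ^ 2 * g ^ 2 / μ) / 2 * N (w - r) ^ 2 := by positivity
  have h8 := mul_le_mul_of_nonneg_left h5 (show 0 ≤ g ^ 2 / (2 * μ) by positivity)
  rw [inner_add_left] at h3
  have h9 : g * (⟪H w + ∇ G m, w - u⟫ + J w - J u) + LG * a * g / 2 * N (w - r) ^ 2 ≤
      (bregman ω r u - bregman ω r' u + (bregman ω v u - bregman ω v' u)) +
      g ^ 2 / μ * sqErr N q (h₁ - H r) (h₂ - H w) (d - ∇ G m) +
      g * (⟪h₂ - H w, v - w⟫ + ⟪d - ∇ G m, v - r⟫) := by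
    have e1 : ⟪h₂ - H w, w - u⟫ = -⟪h₂ - H w, v - w⟫ - ⟪h₂ - H w, u - v⟫ := by
      simp only [inner_sub_right]; ring
    -- The error of 𝒢 is re-centred at r, not at w, because w already depends on the sample behind
    -- this error; the term with w - r goes to Young's inequality.
    have e2 : ⟪d - ∇ G m, w - u⟫ =
        ⟪d - ∇ G m, w - r⟫ - ⟪d - ∇ G m, v - r⟫ - ⟪d - ∇ G m, u - v⟫ := by
      simp only [inner_sub_right]; ring
    rw [e1, e2] at h2
    -- Origin of the weights in `sqErr`: 3/2 on both errors of ℋ from `prox_step`; one more on the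
    -- second error of ℋ and one on that of 𝒢 from `aux_step`; 1 / (2(1 - q)) from `h6`.
    have e3 : g ^ 2 / μ * sqErr N q (h₁ - H r) (h₂ - H w) (d - ∇ G m) =
        3 * g ^ 2 / (2 * μ) * (dualNorm N (h₂ - H w) ^ 2 + dualNorm N (h₁ - H r) ^ 2) +
        g ^ 2 / (2 * μ) * (2 * (dualNorm N (h₂ - H w) ^ 2 + dualNorm N (d - ∇ G m) ^ 2)) +
        (-g) ^ 2 / (2 * ((1 - q) * μ)) * dualNorm N (d - ∇ G m) ^ 2 := by
      have : 1 - q ≠ 0 := by linarith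
      unfold sqErr
      field_simp
      ring
    have e4 : 3 * LH ^ 2 * g ^ 2 / μ = 2 * (3 * g ^ 2 / (2 * μ) * LH ^ 2) := by
      field_simp
    rw [e4] at h7
    linarith
  have h10 := mul_le_mul_of_nonneg_left h9 (show 0 ≤ a / g by positivity)
  have e5 : a / g * (g * (⟪H w + ∇ G m, w - u⟫ + J w - J u) + LG * a * g / 2 * N (w - r) ^ 2) =
      a * (⟪H w + ∇ G m, w - u⟫ + J w - J u) + LG * a ^ 2 / 2 * N (w - r) ^ 2 := by
    field_simp
  have e6 : ∀ b s t : ℝ, a / g * (b + g ^ 2 / μ * s + g * t) =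
      a / g * b + a * g / μ * s + a * t := fun b s t => by
    field_simp
  rw [e5, e6] at h10
  linarith

end Data

end Deterministic

/-! ### Pathwise bound of the gap along a whole run. -/

/-- The error of the oracle `A` for `F` at the point `x` with the sample `s`. -/
def callErr {E Ξ : Type*} [AddCommGroup E] (A : E → Ξ → E) (F : E → E) (x : E) (s : Ξ) : E :=
  A x s - F x

/-- The auxiliary prox sequence driven by the oracle errors. -/
def IsAux {E : Type*} [NormedAddCommGroup E] [InnerProductSpace ℝ E] [CompleteSpace E]
    (Z : Set E) (ω : E → ℝ) (γ : ℕ → ℝ) (r₁ : E) (δ v : ℕ → E) : Prop :=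
  v 1 = r₁ ∧ ∀ t, 1 ≤ t → IsProx Z ω (fun _ => 0) (v t) (-(γ t • δ t)) (v (t + 1))

namespace Data

variable {E : Type*} [NormedAddCommGroup E] [InnerProductSpace ℝ E] [CompleteSpace E]
  {N : Seminorm ℝ E} {Z : Set E} {G : E → ℝ} {LG : ℝ} {H : E → E} {LH : ℝ}
  {J ω : E → ℝ} {μ ΩZ : ℝ} {α γ : ℕ → ℝ} {q : ℝ}

theorem gap_le (D : Data N Z G LG H LH J ω μ ΩZ α γ q) {x : E} {C : ℝ}
    (h : ∀ u ∈ Z, gapQ G H J x u ≤ C) : gap Z G H J x ≤ C :=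
  csSup_le (D.nonempty.image _) (by rintro _ ⟨u, hu, rfl⟩; exact h u hu)

section Run

variable {Ξ : Type*} {𝒢 ℋ : E → Ξ → E} {r₁ : E} {ξ ζ : ℕ → Ξ} {r w wag wmd v : ℕ → E}

theorem run_r_mem (R : IsRun Z ω J 𝒢 ℋ α γ r₁ ξ ζ r w wag wmd) (hr₁ : r₁ ∈ Z) {t : ℕ}
    (ht : 1 ≤ t) : r t ∈ Z := by
  rcases ht.eq_or_lt with rfl | h
  · rwa [R.r_one]
  · obtain ⟨s, rfl⟩ : ∃ s, t = s + 1 := ⟨t - 1, by omega⟩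
    exact (R.r_succ s (by omega)).1

theorem run_w_mem (R : IsRun Z ω J 𝒢 ℋ α γ r₁ ξ ζ r w wag wmd) {t : ℕ}
    (ht : 1 ≤ t) : w (t + 1) ∈ Z := (R.w_succ t ht).1

theorem aux_mem {δ : ℕ → E} (hv : IsAux Z ω γ r₁ δ v) (hr₁ : r₁ ∈ Z) {t : ℕ} (ht : 1 ≤ t) :
    v t ∈ Z := by
  rcases ht.eq_or_lt with rfl | h
  · rwa [hv.1]
  · obtain ⟨s, rfl⟩ : ∃ s, t = s + 1 := ⟨t - 1, by omega⟩
    exact (hv.2 s (by omega)).1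

theorem run_wag_mem (D : Data N Z G LG H LH J ω μ ΩZ α γ q)
    (R : IsRun Z ω J 𝒢 ℋ α γ r₁ ξ ζ r w wag wmd) (hr₁ : r₁ ∈ Z) {t : ℕ} (ht : 1 ≤ t) :
    wag t ∈ Z := by
  induction t, ht using Nat.le_induction with
  | base => rwa [R.wag_one]
  | succ n hn ih =>
    rw [R.wag_succ n hn]
    exact D.convex ih (run_w_mem R hn) (sub_nonneg.2 (D.α_le_one hn)) (D.α_nonneg hn) (by ring)

theorem run_wmd_mem (D : Data N Z G LG H LH J ω μ ΩZ α γ q)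
    (R : IsRun Z ω J 𝒢 ℋ α γ r₁ ξ ζ r w wag wmd) (hr₁ : r₁ ∈ Z) {t : ℕ} (ht : 1 ≤ t) :
    wmd t ∈ Z := by
  rw [R.wmd_eq t ht]
  exact D.convex (D.run_wag_mem R hr₁ ht) (run_r_mem R hr₁ ht) (sub_nonneg.2 (D.α_le_one ht))
    (D.α_nonneg ht) (by ring)

end Run

variable [FiniteDimensional ℝ E]

section Gap

/-- J is only lower semicontinuous, so it enters through a lower bound on the compact set Z; the
other terms are continuous on Z × Z. -/
theorem exists_lower_bound (D : Data N Z G LG H LH J ω μ ΩZ α γ q) :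
    ∃ C, ∀ x ∈ Z, ∀ u ∈ Z, -G u + ⟪H u, x - u⟫ - J u ≤ C := by
  obtain ⟨c, hc⟩ := D.J_lsc.bddBelow_of_isCompact D.isCompact
  have hH := D.continuousOn_H
  have hG := D.continuousOn_G
  obtain ⟨b, hb⟩ := (D.isCompact.prod D.isCompact).bddAbove_image
    (f := fun p : E × E => -G p.2 + ⟪H p.2, p.1 - p.2⟫) (by
      have h2 : Set.MapsTo (Prod.snd : E × E → E) (Z ×ˢ Z) Z := fun p hp => hp.2
      have hH' := hH.comp continuousOn_snd h2
      have hG' := hG.comp continuousOn_snd h2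
      simp only [Function.comp_def] at hH' hG'
      fun_prop)
  refine ⟨b - c, fun x hx u hu => ?_⟩
  have h1 := hb ⟨(x, u), ⟨hx, hu⟩, rfl⟩
  have h2 := hc ⟨u, hu, rfl⟩
  simp only at h1
  linarith

theorem bddAbove_gapQ (D : Data N Z G LG H LH J ω μ ΩZ α γ q) {x : E} (hx : x ∈ Z) :
    BddAbove (gapQ G H J x '' Z) := by
  obtain ⟨C, hC⟩ := D.exists_lower_bound
  refine ⟨G x + J x + C, ?_⟩
  rintro _ ⟨u, hu, rfl⟩
  have := hC x hx u hu
  unfold gapQ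
  linarith

theorem gap_nonneg (D : Data N Z G LG H LH J ω μ ΩZ α γ q) {x : E} (hx : x ∈ Z) :
    0 ≤ gap Z G H J x :=
  le_csSup (D.bddAbove_gapQ hx) ⟨x, hx, by simp [gapQ]⟩

/-- Serves measurability: lower semicontinuity survives the uncountable supremum over u, whereas
measurability by itself would not. -/
theorem lowerSemicontinuousOn_gap (D : Data N Z G LG H LH J ω μ ΩZ α γ q) :
    LowerSemicontinuousOn (gap Z G H J) Z := by
  have h1 : gap Z G H J = fun x => ⨆ u : Z, gapQ G H J x u := by
    funext x
    rw [gap, sSup_image']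
  rw [h1]
  refine lowerSemicontinuousOn_ciSup (fun x hx => ?_) fun u => ?_
  · have := D.bddAbove_gapQ hx
    rwa [Set.image_eq_range] at this
  · have h2 : ContinuousOn (fun x => G x - G u + ⟪H u, x - u⟫ - J u) Z := by
      have hG := D.continuousOn_G
      fun_prop
    have h3 := h2.lowerSemicontinuousOn.add D.J_lsc
    have h4 : (fun x => G x - G u + ⟪H u, x - u⟫ - J u + J x) = fun x => gapQ G H J x u :=
      funext fun x => by simp only [gapQ]; ring
    rwa [h4] at h3

end Gap

section Run

variable {Ξ : Type*} {𝒢 ℋ : E → Ξ → E} {r₁ : E} {ξ ζ : ℕ → Ξ} {r w wag wmd v : ℕ → E}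

/-- The potential of the method after `t` iterations. -/
theorem run_potential (D : Data N Z G LG H LH J ω μ ΩZ α γ q)
    (R : IsRun Z ω J 𝒢 ℋ α γ r₁ ξ ζ r w wag wmd) (hr₁ : r₁ ∈ Z)
    (hv : IsAux Z ω γ r₁ (fun t => callErr ℋ H (w (t + 1)) (ζ (2 * t)) +
      callErr 𝒢 (∇ G) (wmd t) (ξ t)) v) {u : E} (hu : u ∈ Z) {t : ℕ} (ht : 1 ≤ t) :
    gapQ G H J (wag (t + 1)) u / Gam α t +
      α t / (Gam α t * γ t) * (bregman ω (r (t + 1)) u + bregman ω (v (t + 1)) u) ≤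
    α t / (Gam α t * γ t) * (2 * ΩZ ^ 2) +
      ∑ i ∈ Icc 1 t, (α i * γ i / (μ * Gam α i) *
          sqErr N q (callErr ℋ H (r i) (ζ (2 * i - 1))) (callErr ℋ H (w (i + 1)) (ζ (2 * i)))
            (callErr 𝒢 (∇ G) (wmd i) (ξ i)) +
        α i / Gam α i * (⟪callErr ℋ H (w (i + 1)) (ζ (2 * i)), v i - w (i + 1)⟫ +
          ⟪callErr 𝒢 (∇ G) (wmd i) (ξ i), v i - r i⟫)) := by
  have key : ∀ n, 1 ≤ n → gapQ G H J (wag (n + 1)) u / Gam α n ≤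
      (1 - α n) * gapQ G H J (wag n) u / Gam α n +
      α n / (Gam α n * γ n) * (bregman ω (r n) u - bregman ω (r (n + 1)) u +
        (bregman ω (v n) u - bregman ω (v (n + 1)) u)) +
      (α n * γ n / (μ * Gam α n) *
          sqErr N q (callErr ℋ H (r n) (ζ (2 * n - 1))) (callErr ℋ H (w (n + 1)) (ζ (2 * n)))
            (callErr 𝒢 (∇ G) (wmd n) (ξ n)) +
        α n / Gam α n * (⟪callErr ℋ H (w (n + 1)) (ζ (2 * n)), v n - w (n + 1)⟫ +
          ⟪callErr 𝒢 (∇ G) (wmd n) (ξ n), v n - r n⟫)) := fun n hn => by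
    have h := D.iteration (D.γ_pos n hn) (D.α_nonneg hn) (D.α_le_one hn) (D.step n hn)
      (run_r_mem R hr₁ hn) hu (D.run_wag_mem R hr₁ hn) (aux_mem hv hr₁ hn) (R.w_succ n hn)
      (R.r_succ n hn) (R.wmd_eq n hn) (R.wag_succ n hn) (hv.2 n hn)
    have hΓ := D.Gam_pos n
    have hγ := D.γ_pos n hn
    have hμ := D.μ_pos
    refine (div_le_div_of_nonneg_right h hΓ.le).trans (le_of_eq ?_)
    unfold callErr
    field_simp
    ring
  have hnn : ∀ n, 1 ≤ n → 0 ≤ α n / (Gam α n * γ n) := fun n hn =>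
    div_nonneg (D.α_nonneg hn) (mul_pos (D.Gam_pos n) (D.γ_pos n hn)).le
  have hbr : ∀ n, 1 ≤ n → bregman ω (r n) u + bregman ω (v n) u ≤ 2 * ΩZ ^ 2 := fun n hn => by
    linarith [D.bregman_le _ (run_r_mem R hr₁ hn) u hu, D.bregman_le _ (aux_mem hv hr₁ hn) u hu]
  induction t, ht using Nat.le_induction with
  | base =>
    have h1 := key 1 le_rfl
    have h2 := mul_le_mul_of_nonneg_left (hbr 1 le_rfl) (hnn 1 le_rfl)
    -- Since α_1 = 1, the gap at the starting point drops out.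
    rw [D.α_one, sub_self, zero_mul, zero_div] at h1
    rw [Icc_self, sum_singleton]
    rw [D.α_one] at *
    linarith
  | succ n hn ih =>
    have h1 := key (n + 1) (by omega)
    -- The weights α/(Γγ) are nondecreasing, so raising the weight of the Bregman terms kept on the
    -- left costs at most its increment times 2Ω_Z²; these costs telescope.
    have h2 := mul_le_mul_of_nonneg_left (hbr (n + 1) (by omega)) (sub_nonneg.2 (D.mono n hn))
    -- The recursion of Γ is made for this cancellation.
    have h3 : (1 - α (n + 1)) * gapQ G H J (wag (n + 1)) u / Gam α (n + 1) =
        gapQ G H J (wag (n + 1)) u / Gam α n := by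
      have := (D.α_mem (n + 1) (by omega)).2
      rw [Gam_succ hn, mul_div_mul_left _ _ (by linarith)]
    rw [sum_Icc_succ_top (by omega)]
    rw [h3] at h1
    linarith

/-- The deterministic bound of the gap in terms of the oracle errors. -/
theorem gap_run_le (D : Data N Z G LG H LH J ω μ ΩZ α γ q)
    (R : IsRun Z ω J 𝒢 ℋ α γ r₁ ξ ζ r w wag wmd) (hr₁ : r₁ ∈ Z)
    (hv : IsAux Z ω γ r₁ (fun t => callErr ℋ H (w (t + 1)) (ζ (2 * t)) +
      callErr 𝒢 (∇ G) (wmd t) (ξ t)) v) {t : ℕ} (ht : 1 ≤ t) :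
    gap Z G H J (wag (t + 1)) ≤ 2 * α t / γ t * ΩZ ^ 2 + Gam α t *
      ∑ i ∈ Icc 1 t, (α i * γ i / (μ * Gam α i) *
          sqErr N q (callErr ℋ H (r i) (ζ (2 * i - 1))) (callErr ℋ H (w (i + 1)) (ζ (2 * i)))
            (callErr 𝒢 (∇ G) (wmd i) (ξ i)) +
        α i / Gam α i * (⟪callErr ℋ H (w (i + 1)) (ζ (2 * i)), v i - w (i + 1)⟫ +
          ⟪callErr 𝒢 (∇ G) (wmd i) (ξ i), v i - r i⟫)) := by
  refine D.gap_le fun u hu => ?_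
  have h1 := D.run_potential R hr₁ hv hu ht
  have hΓ := D.Gam_pos t
  have hγ := D.γ_pos t ht
  have h2 : 0 ≤ α t / (Gam α t * γ t) *
      (bregman ω (r (t + 1)) u + bregman ω (v (t + 1)) u) :=
    mul_nonneg (div_nonneg (D.α_nonneg ht) (mul_pos hΓ hγ).le)
      (add_nonneg (D.bregman_nonneg (run_r_mem R hr₁ (by omega)) hu)
        (D.bregman_nonneg (aux_mem hv hr₁ (by omega)) hu))
  have h3 := (le_add_of_nonneg_right h2).trans h1
  rw [div_le_iff₀ hΓ, add_mul] at h3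
  refine h3.trans (le_of_eq ?_)
  congr 1
  · field_simp
  · exact mul_comm _ _

end Run

end Data

/-! ### Exponential moments and tail bounds. -/

section Tails

/-- Markov's inequality for the exponential of a random variable. -/
theorem measureReal_lt_le_exp {Ω : Type*} [MeasurableSpace Ω] {P : Measure Ω}
    [IsFiniteMeasure P] {S : Ω → ℝ} (hS : Measurable S) {b B : ℝ}
    (h : ∫⁻ o, ENNReal.ofReal (Real.exp (S o)) ∂P ≤ ENNReal.ofReal (Real.exp b)) :
    P.real {o | B < S o} ≤ Real.exp (b - B) := by
  have h1 := mul_meas_ge_le_lintegral (μ := P)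
    (f := fun o => ENNReal.ofReal (Real.exp (S o))) (by fun_prop) (ENNReal.ofReal (Real.exp B))
  have h2 : P {o | B < S o} ≤
      P {o | ENNReal.ofReal (Real.exp B) ≤ ENNReal.ofReal (Real.exp (S o))} :=
    measure_mono fun o ho => ENNReal.ofReal_le_ofReal
      (Real.exp_le_exp.2 (show B < S o from ho).le)
  have h3 := (mul_le_mul_right h2 (ENNReal.ofReal (Real.exp B))).trans (h1.trans h)
  have h4 := ENNReal.toReal_mono ENNReal.ofReal_ne_top h3
  rw [ENNReal.toReal_mul, ENNReal.toReal_ofReal (Real.exp_pos _).le,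
    ENNReal.toReal_ofReal (Real.exp_pos _).le] at h4
  rw [Real.exp_sub, le_div_iff₀ (Real.exp_pos _), mul_comm]
  exact h4

/-- The linear term integrates to zero for a centred variable, leaving a moment of the square.
Taylor bounds settle x ≤ 1, Taylor bounds shifted by 1 settle [1, 16/9], and beyond 16/9 already x ≤
9x²/16. -/
theorem exp_le_add_exp_sq (x : ℝ) : Real.exp x ≤ x + Real.exp (9 * x ^ 2 / 16) := by
  rcases le_total x 0 with hx | hx
  · obtain ⟨s, hs, rfl⟩ : ∃ s : ℝ, 0 ≤ s ∧ x = -s := ⟨-x, by linarith, by simp⟩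
    have h1 := Real.quadratic_le_exp_of_nonneg hs
    have h2 := Real.add_one_le_exp (9 * (-s) ^ 2 / 16)
    have h3 : Real.exp (-s) ≤ 1 - s + s ^ 2 / 2 := by
      rw [Real.exp_neg, inv_le_iff_one_le_mul₀ (Real.exp_pos s)]
      have : 0 ≤ 1 - s + s ^ 2 / 2 := by nlinarith [sq_nonneg (s - 1)]
      nlinarith [mul_le_mul_of_nonneg_left h1 this, pow_nonneg hs 4]
    nlinarith [sq_nonneg s]
  have hcubic : ∀ y : ℝ, 0 ≤ y → 1 + y + y ^ 2 / 2 + y ^ 3 / 6 ≤ Real.exp y := fun y hy => by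
    have := Real.sum_le_exp_of_nonneg hy 4
    norm_num [Finset.sum_range_succ, Nat.factorial] at this
    linarith
  have hquart : ∀ y : ℝ, 0 ≤ y → y ≤ 1 →
      Real.exp y ≤ 1 + y + y ^ 2 / 2 + y ^ 3 / 6 + 5 / 96 * y ^ 4 := fun y hy hy1 => by
    have := Real.exp_bound' hy hy1 (n := 4) (by norm_num)
    norm_num [Finset.sum_range_succ, Nat.factorial] at this
    linarith
  have h2 := hcubic (9 * x ^ 2 / 16) (by positivity)
  rcases le_total x 1 with hx1 | hx1
  · have h1 := hquart x hx hx1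
    -- The difference of the two Taylor bounds is x² times this polynomial.
    have h3 : 0 ≤ 1 / 16 - x / 6 + (81 / 512 - 5 / 96) * x ^ 2 + 729 / 24576 * x ^ 4 := by
      nlinarith [sq_nonneg (x ^ 2 - 42 / 100), sq_nonneg (x - 636 / 1000)]
    nlinarith [mul_nonneg (sq_nonneg x) h3]
  rcases le_total x (16 / 9) with hx2 | hx2
  · obtain ⟨s, hs, rfl⟩ : ∃ s : ℝ, 0 ≤ s ∧ x = 1 + s := ⟨x - 1, by linarith, by ring⟩
    have h1 := hquart s hs (by linarith)
    have h3 := Real.exp_one_lt_d9.le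
    have h4 : Real.exp (1 + s) ≤
        2.7182818286 * (1 + s + s ^ 2 / 2 + s ^ 3 / 6 + 5 / 96 * s ^ 4) := by
      rw [Real.exp_add]
      exact mul_le_mul h3 h1 (Real.exp_pos _).le (by norm_num)
    refine h4.trans (le_trans ?_ (add_le_add_right h2 _))
    have := pow_nonneg hs 2
    have := pow_nonneg hs 3
    have := pow_nonneg hs 4
    have := pow_nonneg hs 5
    have := pow_nonneg hs 6
    nlinarith
  · have : Real.exp x ≤ Real.exp (9 * x ^ 2 / 16) := Real.exp_le_exp.2 (by nlinarith)
    linarith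

variable {Ω : Type*} [MeasurableSpace Ω] {P : Measure Ω} [IsProbabilityMeasure P]

/-- Below the chord of exp between 0 and W - 1, whose exponential has mean at most 1. The pointwise
bound gives integrability as well. -/
theorem integral_exp_mul_le {W : Ω → ℝ} (hW : AEStronglyMeasurable W P)
    (hint : Integrable (fun o => Real.exp (W o)) P)
    (hle : ∫ o, Real.exp (W o) ∂P ≤ Real.exp 1) {p : ℝ} (hp0 : 0 ≤ p) (hp1 : p ≤ 1) :
    Integrable (fun o => Real.exp (p * W o)) P ∧ ∫ o, Real.exp (p * W o) ∂P ≤ Real.exp p := by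
  have hpt : ∀ o, Real.exp (p * W o) ≤
      Real.exp p * (p * (Real.exp (-1) * Real.exp (W o)) + (1 - p)) := fun o => by
    have h1 := convexOn_exp.2 (Set.mem_univ (W o - 1)) (Set.mem_univ 0) hp0
      (sub_nonneg.2 hp1) (by ring)
    simp only [smul_eq_mul, mul_zero, add_zero, Real.exp_zero, mul_one] at h1
    calc Real.exp (p * W o) = Real.exp p * Real.exp (p * (W o - 1)) := by
          rw [← Real.exp_add]; congr 1; ring
      _ ≤ _ := by
          have h2 : Real.exp (W o - 1) = Real.exp (-1) * Real.exp (W o) := by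
            rw [← Real.exp_add, neg_add_eq_sub]
          rw [h2] at h1
          gcongr
  have hbig : Integrable (fun o =>
      Real.exp p * (p * (Real.exp (-1) * Real.exp (W o)) + (1 - p))) P :=
    (((hint.const_mul _).const_mul _).add (integrable_const _)).const_mul _
  have hi : Integrable (fun o => Real.exp (p * W o)) P :=
    hbig.mono' (Real.continuous_exp.comp_aestronglyMeasurable (hW.const_mul p))
      (Filter.Eventually.of_forall fun o => by
        rw [Real.norm_eq_abs, abs_of_pos (Real.exp_pos _)]; exact hpt o)
  refine ⟨hi, (integral_mono hi hbig hpt).trans ?_⟩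
  rw [integral_const_mul, integral_add ((hint.const_mul _).const_mul _) (integrable_const _),
    integral_const_mul, integral_const_mul, integral_const]
  simp only [probReal_univ, one_smul]
  have h2 : Real.exp (-1) * ∫ o, Real.exp (W o) ∂P ≤ 1 := by
    calc _ ≤ Real.exp (-1) * Real.exp 1 := by gcongr
      _ = 1 := by rw [← Real.exp_add]; simp
  have h3 : p * (Real.exp (-1) * ∫ o, Real.exp (W o) ∂P) + (1 - p) ≤ 1 := by nlinarith
  calc _ ≤ Real.exp p * 1 := by gcongr
    _ = _ := mul_one _

/-- The moment generating function of a centered variable with light tails. -/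
theorem integral_exp_mul_le_of_centered {X : Ω → ℝ} (hX : AEStronglyMeasurable X P)
    (hint : Integrable (fun o => Real.exp (X o ^ 2)) P)
    (hle : ∫ o, Real.exp (X o ^ 2) ∂P ≤ Real.exp 1) (hmean : ∫ o, X o ∂P = 0) (θ : ℝ) :
    Integrable (fun o => Real.exp (θ * X o)) P ∧
      ∫ o, Real.exp (θ * X o) ∂P ≤ Real.exp (3 * θ ^ 2 / 4) := by
  have hX2 : AEStronglyMeasurable (fun o => X o ^ 2) P := hX.pow 2
  have hmeas : AEStronglyMeasurable (fun o => Real.exp (θ * X o)) P :=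
    Real.continuous_exp.comp_aestronglyMeasurable (hX.const_mul θ)
  have hXint : Integrable X P := hint.mono' hX (Filter.Eventually.of_forall fun o => by
    have := Real.add_one_le_exp (X o ^ 2)
    rw [Real.norm_eq_abs]
    nlinarith [sq_nonneg (|X o| - 1), sq_abs (X o)])
  -- At 16/9 the exponent 9θ²/16 reaches 1, the largest allowed in `integral_exp_mul_le`. From there
  -- on 2/3 ≤ 3θ²/8, which pays for Young's inequality in the other case.
  rcases le_total (θ ^ 2) (16 / 9) with hθ | hθ
  · obtain ⟨h1, h2⟩ := integral_exp_mul_le hX2 hint hle (p := 9 * θ ^ 2 / 16) (by positivity)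
      (by linarith)
    have hpt : ∀ o, Real.exp (θ * X o) ≤ θ * X o + Real.exp (9 * θ ^ 2 / 16 * X o ^ 2) :=
      fun o => by
        refine (exp_le_add_exp_sq _).trans (le_of_eq ?_)
        congr 2
        ring
    have hbig := (hXint.const_mul θ).add h1
    have hi : Integrable (fun o => Real.exp (θ * X o)) P :=
      hbig.mono' hmeas (Filter.Eventually.of_forall fun o => by
        rw [Real.norm_eq_abs, abs_of_pos (Real.exp_pos _)]; exact hpt o)
    refine ⟨hi, (integral_mono hi hbig hpt).trans ?_⟩
    simp only [Pi.add_apply]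
    rw [integral_add (hXint.const_mul θ) h1, integral_const_mul, hmean, mul_zero, zero_add]
    exact h2.trans (Real.exp_le_exp.2 (by nlinarith [sq_nonneg θ]))
  · obtain ⟨h1, h2⟩ := integral_exp_mul_le hX2 hint hle (p := 2 / 3) (by norm_num) (by norm_num)
    have hpt : ∀ o, Real.exp (θ * X o) ≤
        Real.exp (3 * θ ^ 2 / 8) * Real.exp (2 / 3 * X o ^ 2) := fun o => by
      rw [← Real.exp_add, Real.exp_le_exp]
      nlinarith [sq_nonneg (3 * θ - 4 * X o)]
    have hbig := h1.const_mul (Real.exp (3 * θ ^ 2 / 8))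
    have hi : Integrable (fun o => Real.exp (θ * X o)) P :=
      hbig.mono' hmeas (Filter.Eventually.of_forall fun o => by
        rw [Real.norm_eq_abs, abs_of_pos (Real.exp_pos _)]; exact hpt o)
    refine ⟨hi, (integral_mono hi hbig hpt).trans ?_⟩
    rw [integral_const_mul]
    calc _ ≤ Real.exp (3 * θ ^ 2 / 8) * Real.exp (2 / 3) := by gcongr
      _ ≤ _ := by rw [← Real.exp_add, Real.exp_le_exp]; linarith

theorem lintegral_exp_le_of_abs_le {X Y : Ω → ℝ} (hX : AEStronglyMeasurable X P)
    (hint : Integrable (fun o => Real.exp (Y o ^ 2)) P)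
    (hle : ∫ o, Real.exp (Y o ^ 2) ∂P ≤ Real.exp 1) (hmean : ∫ o, X o ∂P = 0) {s : ℝ}
    (hs : 0 ≤ s) (hXY : ∀ᵐ o ∂P, |X o| ≤ s * Y o) (θ : ℝ) :
    ∫⁻ o, ENNReal.ofReal (Real.exp (θ * X o)) ∂P ≤
      ENNReal.ofReal (Real.exp (3 * θ ^ 2 * s ^ 2 / 4)) := by
  rcases hs.eq_or_lt with rfl | hs
  · have h0 : ∀ᵐ o ∂P, ENNReal.ofReal (Real.exp (θ * X o)) = 1 := by
      filter_upwards [hXY] with o ho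
      rw [zero_mul] at ho
      simp [abs_nonpos_iff.1 ho]
    rw [lintegral_congr_ae h0]
    simp
  have hpt : ∀ᵐ o ∂P, Real.exp ((s⁻¹ * X o) ^ 2) ≤ Real.exp (Y o ^ 2) := by
    filter_upwards [hXY] with o ho
    rw [Real.exp_le_exp, sq_le_sq, abs_mul, abs_of_pos (inv_pos.2 hs), inv_mul_le_iff₀ hs]
    exact ho.trans (mul_le_mul_of_nonneg_left (le_abs_self _) hs.le)
  have hX' : AEStronglyMeasurable (fun o => s⁻¹ * X o) P := hX.const_mul _
  have hint' : Integrable (fun o => Real.exp ((s⁻¹ * X o) ^ 2)) P :=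
    hint.mono' (Real.continuous_exp.comp_aestronglyMeasurable (hX'.pow 2)) (by
      filter_upwards [hpt] with o ho
      rwa [Real.norm_eq_abs, abs_of_pos (Real.exp_pos _)])
  obtain ⟨h1, h2⟩ := integral_exp_mul_le_of_centered hX' hint'
    ((integral_mono_ae hint' hint hpt).trans hle) (by rw [integral_const_mul, hmean, mul_zero])
    (θ * s)
  have h3 : ∀ o, θ * s * (s⁻¹ * X o) = θ * X o := fun o => by field_simp
  simp only [h3] at h1 h2
  rw [← ofReal_integral_eq_lintegral_ofReal h1
    (Filter.Eventually.of_forall fun o => (Real.exp_pos _).le)]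
  refine ENNReal.ofReal_le_ofReal (h2.trans (le_of_eq ?_))
  congr 1
  ring

/-- Concentration for sums with conditionally sub-Gaussian increments. -/
theorem measureReal_sum_lt_le {X : ℕ → Ω → ℝ} {s : ℕ → ℝ}
    (hX : ∀ i, 1 ≤ i → Measurable (X i))
    (h : ∀ θ : ℝ, ∀ n, ∫⁻ o, ENNReal.ofReal (Real.exp (θ * ∑ i ∈ Icc 1 (n + 1), X i o)) ∂P ≤
      ENNReal.ofReal (Real.exp (3 * θ ^ 2 * s (n + 1) ^ 2 / 4)) *
        ∫⁻ o, ENNReal.ofReal (Real.exp (θ * ∑ i ∈ Icc 1 n, X i o)) ∂P)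
    (n : ℕ) {l : ℝ} (hl : 0 < l) :
    P.real {o | l * Real.sqrt (∑ i ∈ Icc 1 n, s i ^ 2) < ∑ i ∈ Icc 1 n, X i o} ≤
      Real.exp (-l ^ 2 / 3) := by
  have hmgf : ∀ θ : ℝ, ∀ n, ∫⁻ o, ENNReal.ofReal (Real.exp (θ * ∑ i ∈ Icc 1 n, X i o)) ∂P ≤
      ENNReal.ofReal (Real.exp (3 * θ ^ 2 * (∑ i ∈ Icc 1 n, s i ^ 2) / 4)) := fun θ n => by
    induction n with
    | zero => simp
    | succ n ih =>
      refine (h θ n).trans ((mul_le_mul_right ih _).trans (le_of_eq ?_))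
      rw [← ENNReal.ofReal_mul (Real.exp_pos _).le, ← Real.exp_add, sum_Icc_succ_top (by omega)]
      congr 2
      ring
  have hSm : Measurable fun o => ∑ i ∈ Icc 1 n, X i o :=
    Finset.measurable_sum _ fun i hi => hX i (mem_Icc.1 hi).1
  have htail : ∀ θ : ℝ, 0 < θ → ∀ B : ℝ, P.real {o | B < ∑ i ∈ Icc 1 n, X i o} ≤
      Real.exp (3 * θ ^ 2 * (∑ i ∈ Icc 1 n, s i ^ 2) / 4 - θ * B) := fun θ hθ B => by
    refine le_trans (le_of_eq ?_) (measureReal_lt_le_exp (hSm.const_mul θ) (hmgf θ n))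
    congr 1
    ext o
    simp [hθ]
  set V := ∑ i ∈ Icc 1 n, s i ^ 2 with hV
  have hV0 : 0 ≤ V := sum_nonneg fun i _ => sq_nonneg _
  rcases hV0.eq_or_lt with h0 | hpos
  -- Zero variance: the exponential moments are at most 1 for every θ, so θ = m(k + 1) at level 1/(k
  -- + 1) gives exp(-m) → 0, and the sum is almost surely not positive.
  · rw [← h0, Real.sqrt_zero, mul_zero]
    have hz : ∀ k : ℕ, P {o | ((k : ℝ) + 1)⁻¹ < ∑ i ∈ Icc 1 n, X i o} = 0 := fun k => by
      have hk : (0 : ℝ) < (k : ℝ) + 1 := by positivity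
      have h2 : Filter.Tendsto (fun m : ℕ => Real.exp (-(m : ℝ))) Filter.atTop (nhds 0) :=
        Real.tendsto_exp_neg_atTop_nhds_zero.comp tendsto_natCast_atTop_atTop
      have h3 : P.real {o | ((k : ℝ) + 1)⁻¹ < ∑ i ∈ Icc 1 n, X i o} ≤ 0 := by
        refine ge_of_tendsto h2 ?_
        filter_upwards [Filter.eventually_gt_atTop 0] with m hm
        have hm' : (0 : ℝ) < m := Nat.cast_pos.2 hm
        refine (htail (m * ((k : ℝ) + 1)) (by positivity) _).trans (le_of_eq ?_)
        rw [← h0]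
        congr 1
        field_simp
        simp
      exact (measureReal_eq_zero_iff (by finiteness)).1 (le_antisymm h3 measureReal_nonneg)
    have hU : {o | 0 < ∑ i ∈ Icc 1 n, X i o} ⊆
        ⋃ k : ℕ, {o | ((k : ℝ) + 1)⁻¹ < ∑ i ∈ Icc 1 n, X i o} := fun o ho => by
      obtain ⟨k, hk⟩ := exists_nat_one_div_lt (show (0 : ℝ) < ∑ i ∈ Icc 1 n, X i o from ho)
      exact Set.mem_iUnion.2 ⟨k, by simpa using hk⟩
    have h4 : P {o | 0 < ∑ i ∈ Icc 1 n, X i o} = 0 :=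
      measure_mono_null hU (measure_iUnion_null hz)
    rw [(measureReal_eq_zero_iff (by finiteness)).2 h4]
    exact (Real.exp_pos _).le
  · have hq : 0 < Real.sqrt V := Real.sqrt_pos.2 hpos
    -- The minimiser over θ of 3θ²V/4 - θl√V; the minimum is -l²/3.
    refine (htail (2 * l / (3 * Real.sqrt V)) (by positivity) _).trans (le_of_eq ?_)
    congr 1
    have : V = Real.sqrt V ^ 2 := (Real.sq_sqrt hV0).symm
    field_simp
    rw [← this]
    ring

/-- Concentration for nonnegative combinations of variables with exponential moments. -/
theorem measureReal_weighted_sum_lt_le {W : ℕ → Ω → ℝ} (hW : ∀ i, 1 ≤ i → Measurable (W i))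
    (h : ∀ i, 1 ≤ i → ∫⁻ o, ENNReal.ofReal (Real.exp (W i o)) ∂P ≤ ENNReal.ofReal (Real.exp 1))
    {c : ℕ → ℝ} (hc : ∀ i, 1 ≤ i → 0 ≤ c i) (n : ℕ) (l : ℝ) :
    P.real {o | (1 + l) * ∑ i ∈ Icc 1 n, c i < ∑ i ∈ Icc 1 n, c i * W i o} ≤ Real.exp (-l) := by
  have hc' : ∀ i ∈ Icc 1 n, 0 ≤ c i := fun i hi => hc i (mem_Icc.1 hi).1
  set C := ∑ i ∈ Icc 1 n, c i with hC
  rcases (sum_nonneg hc' : 0 ≤ C).eq_or_lt with h0 | hpos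
  · have hz := (sum_eq_zero_iff_of_nonneg hc').1 h0.symm
    have h1 : ∀ o, ∑ i ∈ Icc 1 n, c i * W i o = 0 := fun o =>
      sum_eq_zero fun i hi => by rw [hz i hi, zero_mul]
    have h2 : {o | (1 + l) * C < ∑ i ∈ Icc 1 n, c i * W i o} = ∅ := by
      ext o
      simp [h1, show C = 0 from h0.symm]
    rw [h2, measureReal_empty]
    exact (Real.exp_pos (-l)).le
  have hSm : Measurable fun o => ∑ i ∈ Icc 1 n, c i / C * W i o :=
    Finset.measurable_sum _ fun i hi => (hW i (mem_Icc.1 hi).1).const_mul _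
  have hw : ∑ i ∈ Icc 1 n, c i / C = 1 := by rw [← sum_div, ← hC, div_self hpos.ne']
  -- Jensen with the normalised weights; no independence of the `W i` is needed.
  have hE : ∫⁻ o, ENNReal.ofReal (Real.exp (∑ i ∈ Icc 1 n, c i / C * W i o)) ∂P ≤
      ENNReal.ofReal (Real.exp 1) := by
    calc _ ≤ ∫⁻ o, ∑ i ∈ Icc 1 n,
          ENNReal.ofReal (c i / C) * ENNReal.ofReal (Real.exp (W i o)) ∂P := by
          refine lintegral_mono fun o => ?_
          have h1 := convexOn_exp.map_sum_le (t := Icc 1 n) (w := fun i => c i / C)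
            (p := fun i => W i o) (fun i hi => div_nonneg (hc' i hi) hpos.le) hw
            fun i _ => Set.mem_univ _
          simp only [smul_eq_mul] at h1
          refine (ENNReal.ofReal_le_ofReal h1).trans (le_of_eq ?_)
          rw [ENNReal.ofReal_sum_of_nonneg fun i hi =>
            mul_nonneg (div_nonneg (hc' i hi) hpos.le) (Real.exp_pos _).le]
          exact sum_congr rfl fun i hi => ENNReal.ofReal_mul (div_nonneg (hc' i hi) hpos.le)
      _ = ∑ i ∈ Icc 1 n, ENNReal.ofReal (c i / C) *
          ∫⁻ o, ENNReal.ofReal (Real.exp (W i o)) ∂P := by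
          rw [lintegral_finsetSum' _ fun i hi => by
            have := hW i (mem_Icc.1 hi).1
            fun_prop]
          exact sum_congr rfl fun i hi => lintegral_const_mul' _ _ ENNReal.ofReal_ne_top
      _ ≤ ∑ i ∈ Icc 1 n, ENNReal.ofReal (c i / C) * ENNReal.ofReal (Real.exp 1) :=
          sum_le_sum fun i hi => mul_le_mul_right (h i (mem_Icc.1 hi).1) _
      _ = ENNReal.ofReal (Real.exp 1) := by
          rw [← sum_mul, ← ENNReal.ofReal_sum_of_nonneg fun i hi =>
            div_nonneg (hc' i hi) hpos.le, hw, ENNReal.ofReal_one, one_mul]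
  have h2 := measureReal_lt_le_exp hSm hE (B := 1 + l)
  refine le_trans (le_of_eq ?_) (h2.trans (le_of_eq (by congr 1; ring)))
  congr 1
  ext o
  have h3 : ∑ i ∈ Icc 1 n, c i / C * W i o = (∑ i ∈ Icc 1 n, c i * W i o) / C := by
    rw [sum_div]; exact sum_congr rfl fun i _ => by ring
  rw [Set.mem_ofPred_eq, Set.mem_ofPred_eq, h3, lt_div_iff₀ hpos]

end Tails

/-! ### Oracle calls at random points independent of the sample. -/

section Calls

variable {Ω 𝒳 Ξ : Type*} [MeasurableSpace Ω] [MeasurableSpace 𝒳] [MeasurableSpace Ξ]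
  {P : Measure Ω} [IsProbabilityMeasure P] {p : Ω → 𝒳} {s : Ω → Ξ}

/-- Fubini on the product law: freeze the past, average over the fresh sample. -/
theorem lintegral_of_indepFun (hp : Measurable p) (hs : Measurable s) (hps : IndepFun p s P)
    {f : 𝒳 × Ξ → ENNReal} (hf : Measurable f) :
    ∫⁻ o, f (p o, s o) ∂P = ∫⁻ o, ∫⁻ o', f (p o, s o') ∂P ∂P := by
  have h1 := (indepFun_iff_map_prod_eq_prod_map_map hp.aemeasurable hs.aemeasurable).1 hps
  have := Measure.isProbabilityMeasure_map (μ := P) hs.aemeasurable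
  have h2 : ∫⁻ o, f (p o, s o) ∂P = ∫⁻ a, ∫⁻ b, f (a, b) ∂P.map s ∂P.map p := by
    rw [← lintegral_prod _ hf.aemeasurable, ← h1, lintegral_map hf (hp.prodMk hs)]
  rw [h2, lintegral_map hf.lintegral_prod_right' hp]
  refine lintegral_congr fun o => ?_
  rw [lintegral_map (by fun_prop) hs]

theorem integral_of_indepFun (hp : Measurable p) (hs : Measurable s) (hps : IndepFun p s P)
    {f : 𝒳 × Ξ → ℝ} (hf : Measurable f) (hi : Integrable (fun o => f (p o, s o)) P) :
    ∫ o, f (p o, s o) ∂P = ∫ o, ∫ o', f (p o, s o') ∂P ∂P := by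
  have h1 := (indepFun_iff_map_prod_eq_prod_map_map hp.aemeasurable hs.aemeasurable).1 hps
  have := Measure.isProbabilityMeasure_map (μ := P) hs.aemeasurable
  have := Measure.isProbabilityMeasure_map (μ := P) hp.aemeasurable
  have h3 : Integrable f ((P.map p).prod (P.map s)) := by
    rw [← h1, integrable_map_measure hf.aestronglyMeasurable (hp.prodMk hs).aemeasurable]
    exact hi
  have h2 : ∫ o, f (p o, s o) ∂P = ∫ a, ∫ b, f (a, b) ∂P.map s ∂P.map p := by
    rw [← integral_prod _ h3, ← h1,
      integral_map (hp.prodMk hs).aemeasurable hf.aestronglyMeasurable]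
  rw [h2, integral_map hp.aemeasurable
    hf.stronglyMeasurable.integral_prod_right'.aestronglyMeasurable]
  refine integral_congr_ae (Filter.Eventually.of_forall fun o => ?_)
  exact integral_map hs.aemeasurable
    (hf.comp measurable_prodMk_left).aestronglyMeasurable

variable {E : Type*} [NormedAddCommGroup E] [InnerProductSpace ℝ E] [FiniteDimensional ℝ E]
  [MeasurableSpace E] [BorelSpace E] {A : E → Ξ → E} {F : E → E} {Z : Set E} {x y : 𝒳 → E}

theorem measurable_callErr (hA : Measurable (Function.uncurry A)) (hx : Measurable x)
    (hF : Measurable fun a => F (x a)) :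
    Measurable fun b : 𝒳 × Ξ => callErr A F (x b.1) b.2 := by
  have h1 : Measurable fun b : 𝒳 × Ξ => A (x b.1) b.2 :=
    hA.comp ((hx.comp measurable_fst).prodMk measurable_snd)
  exact h1.sub (hF.comp measurable_fst)

/-- Moments of an oracle error at a random point that is independent of the sample. -/
theorem lintegral_callErr_le (hp : Measurable p) (hs : Measurable s) (hps : IndepFun p s P)
    (hA : Measurable (Function.uncurry A)) (hx : Measurable x)
    (hF : Measurable fun a => F (x a)) (hxZ : ∀ a, x a ∈ Z) {Φ : E → ENNReal} (hΦ : Measurable Φ)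
    {K : ENNReal} (h : ∀ z ∈ Z, ∫⁻ o, Φ (callErr A F z (s o)) ∂P ≤ K) :
    ∫⁻ o, Φ (callErr A F (x (p o)) (s o)) ∂P ≤ K := by
  have := lintegral_of_indepFun hp hs hps (hΦ.comp (measurable_callErr hA hx hF))
  simp only [Function.comp_def] at this
  rw [this]
  calc _ ≤ ∫⁻ _, K ∂P := lintegral_mono fun o => h _ (hxZ _)
    _ = K := by simp

/-- An unbiased oracle error is orthogonal to the past. -/
theorem integral_inner_callErr (hp : Measurable p) (hs : Measurable s) (hps : IndepFun p s P)
    (hA : Measurable (Function.uncurry A)) (hx : Measurable x)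
    (hF : Measurable fun a => F (x a)) (hy : Measurable y) (hxZ : ∀ a, x a ∈ Z)
    (hmean : ∀ z ∈ Z, ∀ d : E, ∫ o, ⟪callErr A F z (s o), d⟫ ∂P = 0)
    (hi : Integrable (fun o => ⟪callErr A F (x (p o)) (s o), y (p o)⟫) P) :
    ∫ o, ⟪callErr A F (x (p o)) (s o), y (p o)⟫ ∂P = 0 := by
  have hf : Measurable fun b : 𝒳 × Ξ => ⟪callErr A F (x b.1) b.2, y b.1⟫ :=
    (measurable_callErr hA hx hF).inner (hy.comp measurable_fst)
  have h2 := integral_of_indepFun hp hs hps hf hi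
  simp only at h2
  rw [h2]
  simp [hmean _ (hxZ _)]

/-- Multiplying by the exponential of a new conditionally sub-Gaussian increment. -/
theorem lintegral_mul_exp_inner_callErr_le (hp : Measurable p) (hs : Measurable s)
    (hps : IndepFun p s P) (hA : Measurable (Function.uncurry A)) (hx : Measurable x)
    (hF : Measurable fun a => F (x a)) (hy : Measurable y)
    {g : 𝒳 → ENNReal} (hg : Measurable g) {θ : ℝ} {K : ENNReal}
    (h : ∀ a, ∫⁻ o, ENNReal.ofReal (Real.exp (θ * ⟪callErr A F (x a) (s o), y a⟫)) ∂P ≤ K) :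
    ∫⁻ o, g (p o) *
      ENNReal.ofReal (Real.exp (θ * ⟪callErr A F (x (p o)) (s o), y (p o)⟫)) ∂P ≤
      K * ∫⁻ o, g (p o) ∂P := by
  have hf : Measurable fun b : 𝒳 × Ξ => ⟪callErr A F (x b.1) b.2, y b.1⟫ :=
    (measurable_callErr hA hx hF).inner (hy.comp measurable_fst)
  have hf' : Measurable fun b : 𝒳 × Ξ =>
      ENNReal.ofReal (Real.exp (θ * ⟪callErr A F (x b.1) b.2, y b.1⟫)) := by fun_prop
  have h2 := lintegral_of_indepFun hp hs hps ((hg.comp measurable_fst).mul hf')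
  simp only [Pi.mul_apply, Function.comp_def] at h2
  rw [h2, ← lintegral_const_mul _ (show Measurable fun o => g (p o) from hg.comp hp)]
  refine lintegral_mono fun o => ?_
  have h3 : Measurable fun o' =>
      ENNReal.ofReal (Real.exp (θ * ⟪callErr A F (x (p o)) (s o'), y (p o)⟫)) :=
    hf'.comp (measurable_const.prodMk hs)
  rw [lintegral_const_mul _ h3, mul_comm]
  exact mul_le_mul_left (h _) _

end Calls

/-! ### Measurability of the prox-mapping. -/

section Measurability

theorem measurable_comp_of_continuousOn {E F : Type*} [TopologicalSpace E] [MeasurableSpace E]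
    [BorelSpace E] {Ω : Type*} {m : MeasurableSpace Ω} {Z : Set E} {x : Ω → E}
    [TopologicalSpace F] [MeasurableSpace F]
    [BorelSpace F] {f : E → F} (hf : ContinuousOn f Z) (hx : Measurable x) (hxZ : ∀ o, x o ∈ Z) :
    Measurable fun o => f (x o) :=
  (continuousOn_iff_continuous_domRestrict.1 hf).measurable.comp (hx.subtype_mk (h := hxZ))

theorem measurable_comp_of_lowerSemicontinuousOn {E : Type*} [TopologicalSpace E]
    [MeasurableSpace E] [BorelSpace E] {Ω : Type*} {m : MeasurableSpace Ω} {Z : Set E} {x : Ω → E}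
    {f : E → ℝ} (hf : LowerSemicontinuousOn f Z)
    (hx : Measurable x) (hxZ : ∀ o, x o ∈ Z) : Measurable fun o => f (x o) :=
  (lowerSemicontinuous_restrict_iff.2 hf).measurable.comp (hx.subtype_mk (h := hxZ))

theorem measurable_call {E Ω Ξ : Type*} [MeasurableSpace E] {m : MeasurableSpace Ω}
    [MeasurableSpace Ξ] {x : Ω → E} {A : E → Ξ → E} {s : Ω → Ξ}
    (hA : Measurable (Function.uncurry A)) (hx : Measurable x) (hs : Measurable s) :
    Measurable fun o => A (x o) (s o) :=
  hA.comp (hx.prodMk hs)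

variable {E : Type*} [NormedAddCommGroup E] [InnerProductSpace ℝ E] [FiniteDimensional ℝ E]
  [MeasurableSpace E] [BorelSpace E] {Ω : Type*} {m : MeasurableSpace Ω} {Z : Set E} {x : Ω → E}

theorem measurable_of_inner {c : Ω → E} (h : ∀ d : E, Measurable fun o => ⟪d, c o⟫) :
    Measurable c := by
  have h1 : c = fun o => ∑ i, ⟪stdOrthonormalBasis ℝ E i, c o⟫ • stdOrthonormalBasis ℝ E i :=
    funext fun o => ((stdOrthonormalBasis ℝ E).sum_repr' (c o)).symm
  rw [h1]
  exact Finset.measurable_sum _ fun i _ => (h _).smul_const _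

variable [CompleteSpace E] {ω : E → ℝ}

/-- Although `∇ ω` need not be measurable on `Z`, its tangential component is. -/
theorem measurable_starProjection_gradient (hZ : Convex ℝ Z)
    (hω : ∀ z ∈ Z, DifferentiableAt ℝ ω z) (hx : Measurable x) (hxZ : ∀ o, x o ∈ Z) :
    Measurable fun o => (vectorSpan ℝ Z).starProjection (∇ ω (x o)) := by
  have hωc : ContinuousOn ω Z := fun z hz => (hω z hz).continuousAt.continuousWithinAt
  -- Towards a fixed u in Z the derivative is a limit of difference quotients of ω inside Z, where ω
  -- is continuous. Differences of two such directions span the direction space of Z.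
  have h1 : ∀ u ∈ Z, Measurable fun o => ⟪∇ ω (x o), u - x o⟫ := fun u hu => by
    refine measurable_of_tendsto_metrizable (f := fun (n : ℕ) o =>
      ((n : ℝ) + 1) * (ω (x o + ((n : ℝ) + 1)⁻¹ • (u - x o)) - ω (x o))) (fun n => ?_)
      (tendsto_pi_nhds.2 fun o => tendsto_slope_gradient (hω _ (hxZ o)) _)
    have h2 : Measurable fun o => ω (x o + ((n : ℝ) + 1)⁻¹ • (u - x o)) :=
      measurable_comp_of_continuousOn hωc (hx.add ((measurable_const.sub hx).const_smul _))
        fun o => segment_mem hZ (hxZ o) hu n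
    exact (h2.sub (measurable_comp_of_continuousOn hωc hx hxZ)).const_mul _
  have h3 : ∀ d ∈ vectorSpan ℝ Z, Measurable fun o => ⟪∇ ω (x o), d⟫ := fun d hd => by
    rw [vectorSpan_def] at hd
    induction hd using Submodule.span_induction with
    | mem d hd =>
      obtain ⟨u, hu, u', hu', rfl⟩ := hd
      have h4 : (fun o => ⟪∇ ω (x o), u -ᵥ u'⟫) =
          fun o => ⟪∇ ω (x o), u - x o⟫ - ⟪∇ ω (x o), u' - x o⟫ := by
        funext o
        rw [← inner_sub_right, sub_sub_sub_cancel_right, vsub_eq_sub]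
      simp only [h4]
      exact (h1 u hu).sub (h1 u' hu')
    | zero => simp
    | add a b _ _ ha hb => simp only [inner_add_right]; exact ha.add hb
    | smul c a _ ha => simpa only [real_inner_smul_right] using ha.const_mul c
  refine measurable_of_inner fun d => ?_
  have h5 := h3 _ ((vectorSpan ℝ Z).starProjection_apply_mem d)
  have h6 : ∀ o, ⟪∇ ω (x o), (vectorSpan ℝ Z).starProjection d⟫ =
      ⟪d, (vectorSpan ℝ Z).starProjection (∇ ω (x o))⟫ := fun o => by
    rw [real_inner_comm, Submodule.inner_starProjection_left_eq_right]
  simpa only [h6] using h5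

/-- The prox-mapping is measurable. -/
theorem measurable_of_isProx {N : Seminorm ℝ E} {μ : ℝ} {J : E → ℝ} (hN : ∀ x, N x = 0 → x = 0)
    (hμ : 0 < μ) (hZ : Convex ℝ Z) (hω : ∀ z ∈ Z, DifferentiableAt ℝ ω z)
    (hωc : StronglyConvexOn N μ Z ω) (hJ : ConvexOn ℝ Z J) {z η : Ω → E} (hz : Measurable z)
    (hzZ : ∀ o, z o ∈ Z) (hη : Measurable η) (hx : ∀ o, IsProx Z ω J (z o) (η o) (x o)) :
    Measurable x := by
  set S := vectorSpan ℝ Z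
  -- The prox problem sees η - ∇ω(z) only against differences of points of Z, hence only this
  -- projection. By stability x is a Lipschitz function of it, which extends from the range of c to
  -- the whole space.
  set c : Ω → E := fun o => S.starProjection (η o - ∇ ω (z o)) with hc
  have hcm : Measurable c := by
    simp only [hc, map_sub]
    exact (S.starProjection.measurable.comp hη).sub
      (measurable_starProjection_gradient hZ hω hz hzZ)
  obtain ⟨b, hb, hbN⟩ := exists_le_seminorm hN
  have hlip : ∀ o o', ‖x o - x o'‖ ≤ (μ * b ^ 2)⁻¹ * ‖c o - c o'‖ := fun o o' => by
    have h1 := (hx o).stability hZ hJ hωc (hx o') (hω _ (hx o).1) (hω _ (hx o').1)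
    have h2 : S.starProjection (x o' - x o) = x o' - x o :=
      Submodule.starProjection_eq_self_iff.2 (vsub_mem_vectorSpan ℝ (hx o').1 (hx o).1)
    rw [← h2, ← Submodule.inner_starProjection_left_eq_right,
      map_sub S.starProjection] at h1
    have h3 := h1.trans (real_inner_le_norm _ _)
    rw [norm_sub_rev (x o')] at h3
    rw [inv_mul_eq_div, le_div_iff₀ (by positivity)]
    rcases (norm_nonneg (x o - x o')).eq_or_lt with h0 | h0
    · rw [← h0, zero_mul]; exact norm_nonneg _
    have h4 : μ * (b * ‖x o - x o'‖) ^ 2 ≤ μ * N (x o - x o') ^ 2 := by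
      gcongr; exact hbN _
    refine le_of_mul_le_mul_right ?_ h0
    calc _ = μ * (b * ‖x o - x o'‖) ^ 2 := by ring
      _ ≤ _ := h4.trans h3
  have hfac : Function.FactorsThrough x c := fun o o' h => by
    have := hlip o o'
    rw [h, sub_self, norm_zero, mul_zero] at this
    exact sub_eq_zero.1 (norm_le_zero_iff.1 this)
  have hL : LipschitzOnWith ⟨(μ * b ^ 2)⁻¹, by positivity⟩ (Function.extend c x 0)
      (Set.range c) := by
    refine LipschitzOnWith.of_dist_le_mul ?_
    rintro _ ⟨o, rfl⟩ _ ⟨o', rfl⟩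
    rw [hfac.extend_apply, hfac.extend_apply, dist_eq_norm, dist_eq_norm]
    exact hlip o o'
  obtain ⟨g, hg, hgeq⟩ := hL.extend_finite_dimension
  have hxg : x = fun o => g (c o) := funext fun o => by
    rw [← hgeq ⟨o, rfl⟩, hfac.extend_apply]
  rw [hxg]
  exact hg.continuous.measurable.comp hcm

end Measurability

/-! ### The filtration generated by the samples. -/

section Past

variable {Ω Ξ : Type*} [MeasurableSpace Ξ]

/-- The σ-algebra generated by `ξ_1, …, ξ_a` and `ζ_1, …, ζ_b`. -/
abbrev past (ξ ζ : ℕ → Ω → Ξ) (a b : ℕ) : MeasurableSpace Ω :=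
  ⨆ k ∈ {k : ℕ ⊕ ℕ | Sum.elim (· < a) (· < b) k},
    MeasurableSpace.comap (Sum.elim (fun i : ℕ => ξ (i + 1)) (fun i : ℕ => ζ (i + 1)) k)
      inferInstance

variable {ξ ζ : ℕ → Ω → Ξ}

theorem past_mono {a b a' b' : ℕ} (ha : a ≤ a') (hb : b ≤ b') : past ξ ζ a b ≤ past ξ ζ a' b' := by
  refine biSup_mono fun k hk => ?_
  rcases k with k | k
  · exact lt_of_lt_of_le (show k < a from hk) ha
  · exact lt_of_lt_of_le (show k < b from hk) hb

theorem measurable_past_left {a b i : ℕ} (h : i < a) : Measurable[past ξ ζ a b] (ξ (i + 1)) := by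
  refine Measurable.mono (comap_measurable (ξ (i + 1))) ?_ le_rfl
  exact le_iSup₂_of_le (Sum.inl i) h le_rfl

theorem measurable_past_right {a b i : ℕ} (h : i < b) : Measurable[past ξ ζ a b] (ζ (i + 1)) := by
  refine Measurable.mono (comap_measurable (ζ (i + 1))) ?_ le_rfl
  exact le_iSup₂_of_le (Sum.inr i) h le_rfl

variable [mΩ : MeasurableSpace Ω] {P : Measure Ω}

theorem comap_sample_le (hξ : ∀ i, 1 ≤ i → Measurable (ξ i)) (hζ : ∀ i, 1 ≤ i → Measurable (ζ i))
    (k : ℕ ⊕ ℕ) : MeasurableSpace.comap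
      (Sum.elim (fun i : ℕ => ξ (i + 1)) (fun i : ℕ => ζ (i + 1)) k) inferInstance ≤ mΩ := by
  rcases k with k | k
  · exact (hξ (k + 1) (by omega)).comap_le
  · exact (hζ (k + 1) (by omega)).comap_le

theorem past_le (hξ : ∀ i, 1 ≤ i → Measurable (ξ i)) (hζ : ∀ i, 1 ≤ i → Measurable (ζ i))
    (a b : ℕ) : past ξ ζ a b ≤ mΩ :=
  iSup₂_le fun k _ => comap_sample_le hξ hζ k

theorem indep_past (hξ : ∀ i, 1 ≤ i → Measurable (ξ i)) (hζ : ∀ i, 1 ≤ i → Measurable (ζ i))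
    (hindep : iIndepFun (Sum.elim (fun i : ℕ => ξ (i + 1)) (fun i : ℕ => ζ (i + 1))) P)
    {a b : ℕ} {k : ℕ ⊕ ℕ} (hk : ¬ Sum.elim (· < a) (· < b) k) :
    Indep (past ξ ζ a b) (MeasurableSpace.comap
      (Sum.elim (fun i : ℕ => ξ (i + 1)) (fun i : ℕ => ζ (i + 1)) k) inferInstance) P := by
  have h1 := indep_iSup_of_disjoint (comap_sample_le hξ hζ) hindep.iIndep
    (S := {k : ℕ ⊕ ℕ | Sum.elim (· < a) (· < b) k}) (T := {k})
    (Set.disjoint_singleton_right.2 hk)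
  rw [_root_.iSup_singleton] at h1
  exact h1

/-- The identity into Ω with the σ-algebra `m` plays the random variable "past", so the Fubini
lemmas apply without listing samples. -/
theorem indepFun_id_past {m : MeasurableSpace Ω} {s : Ω → Ξ}
    (h : Indep m (MeasurableSpace.comap s inferInstance) P) :
    @IndepFun Ω Ω Ξ mΩ m inferInstance id s P := by
  rw [IndepFun_iff_Indep, MeasurableSpace.comap_id]
  exact h

end Past

/-! ### Oracle errors at a deterministic point. -/

section Pointwise

variable {E : Type*} [NormedAddCommGroup E] [InnerProductSpace ℝ E] {Ω Ξ : Type*}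
  {mΩ : MeasurableSpace Ω} {P : @Measure Ω mΩ} {N : Seminorm ℝ E} {Z : Set E} {A : E → Ξ → E}
  {F : E → E} {s : Ω → Ξ} {σ : ℝ}

theorem integral_inner_callErr_const [FiniteDimensional ℝ E] [IsProbabilityMeasure P] {z : E}
    (hi : Integrable (fun o => A z (s o)) P) (hm : ∫ o, A z (s o) ∂P = F z) (d : E) :
    ∫ o, ⟪callErr A F z (s o), d⟫ ∂P = 0 := by
  have h1 : Integrable (fun o => callErr A F z (s o)) P := hi.sub (integrable_const _)
  have h2 := integral_inner (𝕜 := ℝ) h1 d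
  have h3 : ∫ o, callErr A F z (s o) ∂P = 0 := by
    unfold callErr
    rw [integral_sub hi (integrable_const _), hm]
    simp
  simp only [real_inner_comm d] at h2 ⊢
  rw [h2, h3, inner_zero_right]

/-- The light tail condition for one sample. -/
def LightAt {mΩ : MeasurableSpace Ω} (P : @Measure Ω mΩ) (N : Seminorm ℝ E) (Z : Set E)
    (A : E → Ξ → E) (F : E → E) (s : Ω → Ξ) (σ : ℝ) : Prop :=
  ∀ z ∈ Z, (σ = 0 → ∀ᵐ o ∂P, A z (s o) = F z) ∧
    (σ ≠ 0 → Integrable (fun o => Real.exp (dualNorm N (F z - A z (s o)) ^ 2 / σ ^ 2)) P ∧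
      ∫ o, Real.exp (dualNorm N (F z - A z (s o)) ^ 2 / σ ^ 2) ∂P ≤ Real.exp 1)

/-- For σ = 0 the quotient is 0 and the bound reads 1 ≤ e; exactness of the oracle then enters
through `LightAt.ae_le`. -/
theorem LightAt.normalized [IsProbabilityMeasure P] (h : LightAt P N Z A F s σ) {z : E}
    (hz : z ∈ Z) :
    Integrable (fun o => Real.exp ((dualNorm N (callErr A F z (s o)) / σ) ^ 2)) P ∧
      ∫ o, Real.exp ((dualNorm N (callErr A F z (s o)) / σ) ^ 2) ∂P ≤ Real.exp 1 := by
  rcases eq_or_ne σ 0 with rfl | hσ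
  · simp
  · have := (h z hz).2 hσ
    simp only [dualNorm_sub_rev (F z)] at this
    simpa only [div_pow, callErr] using this

theorem LightAt.ae_le [FiniteDimensional ℝ E] (h : LightAt P N Z A F s σ)
    (hN : ∀ x, N x = 0 → x = 0) {z : E} (hz : z ∈ Z) : ∀ᵐ o ∂P, dualNorm N (callErr A F z (s o)) ≤
      σ * (dualNorm N (callErr A F z (s o)) / σ) := by
  rcases eq_or_ne σ 0 with rfl | hσ
  · filter_upwards [(h z hz).1 rfl] with o ho
    obtain ⟨C, -, hC⟩ := exists_dualNorm_le hN
    have := hC (callErr A F z (s o))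
    rw [callErr, ho, sub_self, norm_zero, mul_zero] at this
    simpa [callErr, ho] using this
  · exact Filter.Eventually.of_forall fun o => by rw [mul_div_cancel₀ _ hσ]

end Pointwise

/-! ### Moments and concentration for adapted oracle calls. -/

section Oracle

variable {E : Type*} [NormedAddCommGroup E] [InnerProductSpace ℝ E] [FiniteDimensional ℝ E]
  [MeasurableSpace E] [BorelSpace E] {Ω Ξ : Type*} [MeasurableSpace Ξ]
  {m mΩ : MeasurableSpace Ω} {P : @Measure Ω mΩ}
  {N : Seminorm ℝ E} {Z : Set E} {A : E → Ξ → E} {F : E → E} {x y : Ω → E} {s : Ω → Ξ} {σ : ℝ}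

theorem measurable_callErr_const (hA : Measurable (Function.uncurry A)) (hs : Measurable[mΩ] s)
    (z : E) : Measurable[mΩ] fun o => callErr A F z (s o) :=
  (measurable_call hA measurable_const hs).sub measurable_const

/-- The oracle `A` for `F` is called at the point `x`, determined by the past `m`, with a sample
`s` that is independent of the past. -/
structure IsCall {mΩ : MeasurableSpace Ω} (P : @Measure Ω mΩ) (m : MeasurableSpace Ω)
    (Z : Set E) (A : E → Ξ → E) (F : E → E) (x : Ω → E) (s : Ω → Ξ) : Prop where
  le : m ≤ mΩ
  sample : Measurable[mΩ] s
  indep : Indep m (MeasurableSpace.comap s inferInstance) P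
  oracle : Measurable (Function.uncurry A)
  point : Measurable[m] x
  value : Measurable[m] fun o => F (x o)
  mem : ∀ o, x o ∈ Z

namespace IsCall

theorem measurable_err (h : IsCall P m Z A F x s) {m' : MeasurableSpace Ω} (hm : m ≤ m')
    (hs : Measurable[m'] s) : Measurable[m'] fun o => callErr A F (x o) (s o) :=
  (measurable_call h.oracle (h.point.mono hm le_rfl) hs).sub (h.value.mono hm le_rfl)

theorem measurable_err' (h : IsCall P m Z A F x s) :
    Measurable[mΩ] fun o => callErr A F (x o) (s o) :=
  h.measurable_err h.le h.sample

variable [IsProbabilityMeasure P]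

theorem lintegral_le (h : IsCall P m Z A F x s) {Φ : E → ENNReal} (hΦ : Measurable Φ)
    {K : ENNReal} (hK : ∀ z ∈ Z, ∫⁻ o, Φ (callErr A F z (s o)) ∂P ≤ K) :
    ∫⁻ o, Φ (callErr A F (x o) (s o)) ∂P ≤ K :=
  @lintegral_callErr_le Ω Ω Ξ mΩ m _ P _ id s E _ _ _ _ _ A F Z x (measurable_id'' h.le) h.sample
    (indepFun_id_past h.indep) h.oracle h.point h.value h.mem Φ hΦ K hK

theorem integral_inner (h : IsCall P m Z A F x s) (hy : Measurable[m] y)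
    (hmean : ∀ z ∈ Z, ∀ d : E, ∫ o, ⟪callErr A F z (s o), d⟫ ∂P = 0)
    (hi : Integrable (fun o => ⟪callErr A F (x o) (s o), y o⟫) P) :
    ∫ o, ⟪callErr A F (x o) (s o), y o⟫ ∂P = 0 :=
  @integral_inner_callErr Ω Ω Ξ mΩ m _ P _ id s E _ _ _ _ _ A F Z x y (measurable_id'' h.le)
    h.sample (indepFun_id_past h.indep) h.oracle h.point h.value hy h.mem hmean hi

theorem lintegral_mul_exp_le (h : IsCall P m Z A F x s) (hy : Measurable[m] y) {g : Ω → ENNReal}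
    (hg : Measurable[m] g) {θ : ℝ} {K : ENNReal}
    (hK : ∀ a, ∫⁻ o, ENNReal.ofReal (Real.exp (θ * ⟪callErr A F (x a) (s o), y a⟫)) ∂P ≤ K) :
    ∫⁻ o, g o * ENNReal.ofReal (Real.exp (θ * ⟪callErr A F (x o) (s o), y o⟫)) ∂P ≤
      K * ∫⁻ o, g o ∂P :=
  @lintegral_mul_exp_inner_callErr_le Ω Ω Ξ mΩ m _ P _ id s E _ _ _ _ _ A F x y
    (measurable_id'' h.le) h.sample (indepFun_id_past h.indep) h.oracle h.point h.value hy g hg θ K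
    hK

end IsCall

variable [IsProbabilityMeasure P]

section Variance

/-- The squared error of a call has the same moment bound as at a deterministic point. -/
theorem IsCall.integrable_sq (h : IsCall P m Z A F x s) (hN : ∀ x, N x = 0 → x = 0)
    (hvar : ∀ z ∈ Z, Integrable (fun o => dualNorm N (A z (s o) - F z) ^ 2) P ∧
      ∫ o, dualNorm N (A z (s o) - F z) ^ 2 ∂P ≤ σ ^ 2) :
    Integrable (fun o => dualNorm N (callErr A F (x o) (s o)) ^ 2) P ∧
      ∫ o, dualNorm N (callErr A F (x o) (s o)) ^ 2 ∂P ≤ σ ^ 2 := by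
  have hdm := (continuous_dualNorm hN).measurable
  have h1 := h.lintegral_le (Φ := fun e => ENNReal.ofReal (dualNorm N e ^ 2))
    (K := ENNReal.ofReal (σ ^ 2)) (by fun_prop) fun z hz => by
      simp only [callErr]
      rw [← ofReal_integral_eq_lintegral_ofReal (hvar z hz).1
        (Filter.Eventually.of_forall fun o => sq_nonneg _)]
      exact ENNReal.ofReal_le_ofReal (hvar z hz).2
  have hm : Measurable fun o => dualNorm N (callErr A F (x o) (s o)) ^ 2 :=
    (hdm.comp h.measurable_err').pow_const 2
  have hnn : 0 ≤ᵐ[P] fun o => dualNorm N (callErr A F (x o) (s o)) ^ 2 :=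
    Filter.Eventually.of_forall fun o => sq_nonneg _
  have hi : Integrable (fun o => dualNorm N (callErr A F (x o) (s o)) ^ 2) P := by
    refine ⟨hm.aestronglyMeasurable, ?_⟩
    rw [hasFiniteIntegral_iff_ofReal hnn]
    exact h1.trans_lt ENNReal.ofReal_lt_top
  refine ⟨hi, ?_⟩
  rw [← ofReal_integral_eq_lintegral_ofReal hi hnn] at h1
  exact (ENNReal.ofReal_le_ofReal_iff (sq_nonneg σ)).1 h1

theorem IsCall.integrable_inner (h : IsCall P m Z A F x s) (hN : ∀ x, N x = 0 → x = 0)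
    (hi : Integrable (fun o => dualNorm N (callErr A F (x o) (s o)) ^ 2) P)
    (hy : Measurable[m] y) {ρ : ℝ} (hρ : ∀ o, N (y o) ≤ ρ) :
    Integrable (fun o => ⟪callErr A F (x o) (s o), y o⟫) P := by
  refine Integrable.mono' (((integrable_const 1).add hi).const_mul ρ)
    (h.measurable_err'.inner (hy.mono h.le le_rfl)).aestronglyMeasurable
    (Filter.Eventually.of_forall fun o => ?_)
  have h1 := dualNorm_nonneg hN (callErr A F (x o) (s o))
  have h2 : 0 ≤ ρ := (apply_nonneg N (y o)).trans (hρ o)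
  calc _ ≤ dualNorm N (callErr A F (x o) (s o)) * N (y o) := abs_inner_le_dualNorm hN _ _
    _ ≤ dualNorm N (callErr A F (x o) (s o)) * ρ := by gcongr; exact hρ o
    _ ≤ _ := by
      rw [mul_comm]
      refine mul_le_mul_of_nonneg_left ?_ h2
      simp only [Pi.add_apply]
      nlinarith [sq_nonneg (dualNorm N (callErr A F (x o) (s o)) - 1)]

end Variance

section Light

theorem LightAt.lintegral_exp_inner_le (h : LightAt P N Z A F s σ) (hN : ∀ x, N x = 0 → x = 0)
    (hσ : 0 ≤ σ) (hA : Measurable (Function.uncurry A)) (hs : Measurable[mΩ] s)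
    (hmean : ∀ z ∈ Z, ∀ d : E, ∫ o, ⟪callErr A F z (s o), d⟫ ∂P = 0)
    {z : E} (hz : z ∈ Z) {d : E} {ρ : ℝ} (hd : N d ≤ ρ) (θ : ℝ) :
    ∫⁻ o, ENNReal.ofReal (Real.exp (θ * ⟪callErr A F z (s o), d⟫)) ∂P ≤
      ENNReal.ofReal (Real.exp (3 * θ ^ 2 * (σ * ρ) ^ 2 / 4)) := by
  obtain ⟨h1, h2⟩ := h.normalized hz
  have hρ : 0 ≤ ρ := (apply_nonneg N d).trans hd
  refine lintegral_exp_le_of_abs_le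
    (Y := fun o => dualNorm N (callErr A F z (s o)) / σ)
    ((measurable_callErr_const hA hs z).inner measurable_const).aestronglyMeasurable h1 h2
    (hmean z hz d) (mul_nonneg hσ hρ) ?_ θ
  filter_upwards [h.ae_le hN hz] with o ho
  have h3 := dualNorm_nonneg hN (callErr A F z (s o))
  calc _ ≤ dualNorm N (callErr A F z (s o)) * N d := abs_inner_le_dualNorm hN _ _
    _ ≤ σ * (dualNorm N (callErr A F z (s o)) / σ) * ρ := by gcongr
    _ = _ := by ring

/-- Concentration of the sum of the pairings of the oracle errors with predictable directions. -/
theorem measureReal_sum_inner_lt_le (hN : ∀ x, N x = 0 → x = 0) (hσ : 0 ≤ σ)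
    {𝓜 : ℕ → MeasurableSpace Ω} {x y : ℕ → Ω → E} {s : ℕ → Ω → Ξ} {ρ : ℕ → ℝ}
    (hcall : ∀ i, 1 ≤ i → IsCall P (𝓜 i) Z A F (x i) (s i))
    (hmono : ∀ i, 1 ≤ i → 𝓜 i ≤ 𝓜 (i + 1))
    (hs : ∀ i, 1 ≤ i → Measurable[𝓜 (i + 1)] (s i))
    (hy : ∀ i, 1 ≤ i → Measurable[𝓜 i] (y i)) (hρ : ∀ i, 1 ≤ i → ∀ o, N (y i o) ≤ ρ i)
    (hmean : ∀ i, 1 ≤ i → ∀ z ∈ Z, ∀ d : E, ∫ o, ⟪callErr A F z (s i o), d⟫ ∂P = 0)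
    (hlight : ∀ i, 1 ≤ i → LightAt P N Z A F (s i) σ) (n : ℕ) {l : ℝ} (hl : 0 < l) :
    P.real {o | l * Real.sqrt (∑ i ∈ Icc 1 n, (σ * ρ i) ^ 2) <
      ∑ i ∈ Icc 1 n, ⟪callErr A F (x i o) (s i o), y i o⟫} ≤ Real.exp (-l ^ 2 / 3) := by
  have hm : ∀ i, 1 ≤ i → Measurable[𝓜 (i + 1)] fun o => ⟪callErr A F (x i o) (s i o), y i o⟫ :=
    fun i hi => ((hcall i hi).measurable_err (hmono i hi) (hs i hi)).inner
      ((hy i hi).mono (hmono i hi) le_rfl)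
  have hle : ∀ i j, 1 ≤ i → i ≤ j → 𝓜 i ≤ 𝓜 j := fun i j hi hij => by
    induction j, hij using Nat.le_induction with
    | base => exact le_rfl
    | succ k hk ih => exact ih.trans (hmono k (by omega))
  refine measureReal_sum_lt_le (s := fun i => σ * ρ i)
    (fun i hi => (hm i hi).mono (hcall (i + 1) (by omega)).le le_rfl) (fun θ k => ?_) n hl
  -- The first k pairings belong to the past of call k + 1, so their exponential acts as the frozen
  -- factor there.
  have hsum : Measurable[𝓜 (k + 1)] fun o =>
      ∑ i ∈ Icc 1 k, ⟪callErr A F (x i o) (s i o), y i o⟫ :=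
    Finset.measurable_sum _ fun i hi => (hm i (mem_Icc.1 hi).1).mono
      (hle _ _ (by omega) (by have := (mem_Icc.1 hi).2; omega)) le_rfl
  have hg : Measurable[𝓜 (k + 1)] fun o =>
      ENNReal.ofReal (Real.exp (θ * ∑ i ∈ Icc 1 k, ⟪callErr A F (x i o) (s i o), y i o⟫)) :=
    (Real.measurable_exp.comp (hsum.const_mul θ)).ennreal_ofReal
  have hc := hcall (k + 1) (by omega)
  refine le_trans (le_of_eq ?_) (hc.lintegral_mul_exp_le (hy (k + 1) (by omega)) hg fun a =>
    (hlight (k + 1) (by omega)).lintegral_exp_inner_le hN hσ hc.oracle hc.sample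
      (hmean (k + 1) (by omega)) (hc.mem a) (hρ (k + 1) (by omega) a) θ)
  refine lintegral_congr fun o => ?_
  rw [sum_Icc_succ_top (by omega), mul_add, Real.exp_add, ENNReal.ofReal_mul (Real.exp_pos _).le]

/-- Concentration of the weighted sum of the squared oracle errors. -/
theorem measureReal_sum_sq_lt_le (hN : ∀ x, N x = 0 → x = 0)
    {𝓜 : ℕ → MeasurableSpace Ω} {x : ℕ → Ω → E} {s : ℕ → Ω → Ξ}
    (hcall : ∀ i, 1 ≤ i → IsCall P (𝓜 i) Z A F (x i) (s i))
    (hlight : ∀ i, 1 ≤ i → LightAt P N Z A F (s i) σ) {c : ℕ → ℝ} (hc : ∀ i, 1 ≤ i → 0 ≤ c i)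
    (n : ℕ) (l : ℝ) :
    P.real {o | (1 + l) * (σ ^ 2 * ∑ i ∈ Icc 1 n, c i) <
      ∑ i ∈ Icc 1 n, c i * dualNorm N (callErr A F (x i o) (s i o)) ^ 2} ≤ Real.exp (-l) := by
  have hdm := (continuous_dualNorm hN).measurable
  rcases eq_or_ne σ 0 with rfl | hσ
  -- Exactness is assumed point by point, with exceptional sets depending on the point; Fubini
  -- carries it to the random query points.
  · have h1 : ∀ i, 1 ≤ i → ∀ᵐ o ∂P, dualNorm N (callErr A F (x i o) (s i o)) = 0 := fun i hi => by
      have h2 := (hcall i hi).lintegral_le (Φ := fun e => ENNReal.ofReal (dualNorm N e)) (K := 0)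
        (by fun_prop) fun z hz => by
          refine le_of_eq ((lintegral_congr_ae ?_).trans lintegral_zero)
          filter_upwards [(hlight i hi).ae_le hN hz] with o ho
          rw [zero_mul] at ho
          exact ENNReal.ofReal_of_nonpos ho
      have h3 := (lintegral_eq_zero_iff
        ((hdm.comp (hcall i hi).measurable_err').ennreal_ofReal)).1 (le_antisymm h2 zero_le)
      filter_upwards [h3] with o ho
      exact le_antisymm (ENNReal.ofReal_eq_zero.1 ho) (dualNorm_nonneg hN _)
    have h4 : ∀ᵐ o ∂P, ∀ i, 1 ≤ i → dualNorm N (callErr A F (x i o) (s i o)) = 0 :=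
      ae_all_iff.2 fun i => ae_all_iff.2 (h1 i)
    have h5 : P {o | (1 + l) * ((0 : ℝ) ^ 2 * ∑ i ∈ Icc 1 n, c i) <
        ∑ i ∈ Icc 1 n, c i * dualNorm N (callErr A F (x i o) (s i o)) ^ 2} = 0 := by
      refine measure_eq_zero_iff_ae_notMem.2 ?_
      filter_upwards [h4] with o ho
      have : ∑ i ∈ Icc 1 n, c i * dualNorm N (callErr A F (x i o) (s i o)) ^ 2 = 0 :=
        sum_eq_zero fun i hi => by rw [ho i (mem_Icc.1 hi).1]; ring
      simp [this]
    rw [measureReal_def, h5]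
    exact (Real.exp_pos _).le
  · refine le_trans (le_of_eq ?_) (measureReal_weighted_sum_lt_le (P := P)
      (W := fun i o => (dualNorm N (callErr A F (x i o) (s i o)) / σ) ^ 2)
      (fun i hi => ((hdm.comp (hcall i hi).measurable_err').div_const σ).pow_const 2)
      (fun i hi => ?_) hc n l)
    · congr 1
      ext o
      have h1 : ∑ i ∈ Icc 1 n, c i * dualNorm N (callErr A F (x i o) (s i o)) ^ 2 =
          σ ^ 2 * ∑ i ∈ Icc 1 n, c i * (dualNorm N (callErr A F (x i o) (s i o)) / σ) ^ 2 := by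
        rw [mul_sum]
        refine sum_congr rfl fun i _ => ?_
        field_simp
      have h2 : 0 < σ ^ 2 := by positivity
      rw [Set.mem_ofPred_eq, Set.mem_ofPred_eq, h1, mul_left_comm, mul_lt_mul_iff_right₀ h2]
    · refine (hcall i hi).lintegral_le
        (Φ := fun e => ENNReal.ofReal (Real.exp ((dualNorm N e / σ) ^ 2))) (by fun_prop)
        fun z hz => ?_
      obtain ⟨h1, h2⟩ := (hlight i hi).normalized hz
      rw [← ofReal_integral_eq_lintegral_ofReal h1
        (Filter.Eventually.of_forall fun o => (Real.exp_pos _).le)]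
      exact ENNReal.ofReal_le_ofReal h2

end Light

end Oracle

/-! ### Sizes of the directions and the auxiliary sequence. -/

namespace Data

variable {E : Type*} [NormedAddCommGroup E] [InnerProductSpace ℝ E] [CompleteSpace E]
  {N : Seminorm ℝ E} {Z : Set E} {G : E → ℝ} {LG : ℝ} {H : E → E} {LH : ℝ}
  {J ω : E → ℝ} {μ ΩZ : ℝ} {α γ : ℕ → ℝ} {q : ℝ}

theorem seminorm_dir_le (D : Data N Z G LG H LH J ω μ ΩZ α γ q)
    {t : ℕ} (ht : 1 ≤ t) {z u : E} (hz : z ∈ Z) (hu : u ∈ Z) :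
    N ((α t / Gam α t) • (u - z)) ≤ α t / Gam α t * (ΩZ * Real.sqrt (2 / μ)) := by
  have h0 := D.μ_pos
  have h1 : 0 ≤ α t / Gam α t := div_nonneg (D.α_nonneg ht) (D.Gam_pos t).le
  rw [map_smul_eq_mul, Real.norm_eq_abs, abs_of_nonneg h1]
  refine mul_le_mul_of_nonneg_left ?_ h1
  refine abs_le_of_sq_le_sq' ?_ (mul_nonneg D.ΩZ_nonneg (Real.sqrt_nonneg _)) |>.2
  rw [mul_pow, Real.sq_sqrt (by positivity), mul_comm]
  exact D.seminorm_sub_sq_le hz hu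

theorem weight_nonneg (D : Data N Z G LG H LH J ω μ ΩZ α γ q) (i : ℕ) (hi : 1 ≤ i) :
    0 ≤ α i * γ i / (μ * Gam α i) :=
  div_nonneg (mul_nonneg (D.α_nonneg hi) (D.γ_pos i hi).le) (mul_pos D.μ_pos (D.Gam_pos i)).le

variable [FiniteDimensional ℝ E]

/-- Built outcome by outcome with a choice of minimisers; the shift by one matches indexing from 1.
Measurability comes afterwards, from `measurable_of_isProx`. -/
theorem exists_aux (D : Data N Z G LG H LH J ω μ ΩZ α γ q) {Ω : Type*} (r₁ : E) (δ : ℕ → Ω → E) :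
    ∃ v : ℕ → Ω → E, ∀ o, IsAux Z ω γ r₁ (fun t => δ t o) fun t => v t o := by
  choose p hp using D.exists_isProx
  let u : ℕ → Ω → E := fun n => Nat.rec (fun _ => r₁)
    (fun k f o => p (f o) (-(γ (k + 1) • δ (k + 1) o))) n
  refine ⟨fun t => u (t - 1), fun o => ⟨rfl, fun t ht => ?_⟩⟩
  obtain ⟨n, rfl⟩ : ∃ n, t = n + 1 := ⟨t - 1, by omega⟩
  exact hp _ _

theorem measurable_prox [MeasurableSpace E] [BorelSpace E]
    (D : Data N Z G LG H LH J ω μ ΩZ α γ q) {Ω : Type*} {m : MeasurableSpace Ω} {z η x : Ω → E}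
    {c : ℝ} (hc : 0 ≤ c) (hz : Measurable[m] z) (hzZ : ∀ o, z o ∈ Z) (hη : Measurable[m] η)
    (hx : ∀ o, IsProx Z ω (fun u => c * J u) (z o) (η o) (x o)) : Measurable[m] x :=
  measurable_of_isProx D.norm_eq_zero D.μ_pos D.convex D.ω_diff D.ω_convex (D.J_convex.smul hc)
    hz hzZ hη hx

end Data

theorem integral_affine_comb {Ω : Type*} [MeasurableSpace Ω] {P : Measure Ω}
    [IsProbabilityMeasure P] {f₁ f₂ f₃ f₄ f₅ : Ω → ℝ} (a g b₁ b₂ b₃ : ℝ) (h₁ : Integrable f₁ P)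
    (h₂ : Integrable f₂ P) (h₃ : Integrable f₃ P) (h₄ : Integrable f₄ P) (h₅ : Integrable f₅ P) :
    Integrable (fun o => a + g * (b₁ * f₁ o + b₂ * f₂ o + b₃ * f₃ o + f₄ o + f₅ o)) P ∧
      ∫ o, a + g * (b₁ * f₁ o + b₂ * f₂ o + b₃ * f₃ o + f₄ o + f₅ o) ∂P =
        a + g * (b₁ * ∫ o, f₁ o ∂P + b₂ * ∫ o, f₂ o ∂P + b₃ * ∫ o, f₃ o ∂P + ∫ o, f₄ o ∂P +
          ∫ o, f₅ o ∂P) := by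
  have i₁ := h₁.const_mul b₁
  have i₂ := h₂.const_mul b₂
  have i₃ := h₃.const_mul b₃
  have i₁₂ : Integrable (fun o => b₁ * f₁ o + b₂ * f₂ o) P := i₁.add i₂
  have i₁₃ : Integrable (fun o => b₁ * f₁ o + b₂ * f₂ o + b₃ * f₃ o) P := i₁₂.add i₃
  have i₁₄ : Integrable (fun o => b₁ * f₁ o + b₂ * f₂ o + b₃ * f₃ o + f₄ o) P := i₁₃.add h₄
  have i₁₅ : Integrable (fun o => b₁ * f₁ o + b₂ * f₂ o + b₃ * f₃ o + f₄ o + f₅ o) P :=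
    i₁₄.add h₅
  refine ⟨(integrable_const a).add (i₁₅.const_mul g), ?_⟩
  rw [integral_add (integrable_const a) (i₁₅.const_mul g), integral_const_mul,
    integral_add i₁₄ h₅, integral_add i₁₃ h₄, integral_add i₁₂ i₃, integral_add i₁ i₂,
    integral_const_mul, integral_const_mul, integral_const_mul]
  simp

/-! ### The random run: adaptedness and the two bounds. -/

section RandomRun

variable {E : Type*} [NormedAddCommGroup E] [InnerProductSpace ℝ E] [FiniteDimensional ℝ E]
  [CompleteSpace E] [MeasurableSpace E] [BorelSpace E]
  {N : Seminorm ℝ E} {Z : Set E} {G : E → ℝ} {LG : ℝ} {H : E → E} {LH : ℝ}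
  {J ω : E → ℝ} {μ ΩZ : ℝ} {α γ : ℕ → ℝ} {q : ℝ}
  {Ω Ξ : Type*} [MeasurableSpace Ξ] {mΩ : MeasurableSpace Ω} {P : @Measure Ω mΩ}
  {ξ ζ : ℕ → Ω → Ξ} {𝒢 ℋ : E → Ξ → E} {r₁ : E} {r w wag wmd v : ℕ → Ω → E} {σG σH : ℝ}

/-- A random run of the method together with its auxiliary prox sequence. -/
structure RandomRun (Z : Set E) (G : E → ℝ) (H : E → E) (J ω : E → ℝ) (α γ : ℕ → ℝ)
    (P : @Measure Ω mΩ) (ξ ζ : ℕ → Ω → Ξ) (𝒢 ℋ : E → Ξ → E) (r₁ : E)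
    (r w wag wmd v : ℕ → Ω → E) : Prop where
  start : r₁ ∈ Z
  ξ_meas : ∀ i, 1 ≤ i → Measurable (ξ i)
  ζ_meas : ∀ i, 1 ≤ i → Measurable (ζ i)
  indep : iIndepFun (Sum.elim (fun i : ℕ => ξ (i + 1)) (fun i : ℕ => ζ (i + 1))) P
  𝒢_meas : Measurable (Function.uncurry 𝒢)
  ℋ_meas : Measurable (Function.uncurry ℋ)
  run : ∀ o : Ω, IsRun Z ω J 𝒢 ℋ α γ r₁ (fun i => ξ i o) (fun i => ζ i o)
    (fun t => r t o) (fun t => w t o) (fun t => wag t o) (fun t => wmd t o)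
  aux : ∀ o : Ω, IsAux Z ω γ r₁ (fun t => callErr ℋ H (w (t + 1) o) (ζ (2 * t) o) +
    callErr 𝒢 (∇ G) (wmd t o) (ξ t o)) (fun t => v t o)

namespace RandomRun

variable (D : Data N Z G LG H LH J ω μ ΩZ α γ q)
  (R : RandomRun Z G H J ω α γ P ξ ζ 𝒢 ℋ r₁ r w wag wmd v)

include R

theorem measurable_wmd {m : MeasurableSpace Ω} {t : ℕ} (ht : 1 ≤ t) (hr : Measurable[m] (r t))
    (hwag : Measurable[m] (wag t)) : Measurable[m] (wmd t) := by
  have h : wmd t = fun o => (1 - α t) • wag t o + α t • r t o :=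
    funext fun o => (R.run o).wmd_eq t ht
  rw [h]
  exact (hwag.const_smul _).add (hr.const_smul _)

include D

theorem measurable_w {m : MeasurableSpace Ω} {t : ℕ} (ht : 1 ≤ t) (hr : Measurable[m] (r t))
    (hwmd : Measurable[m] (wmd t)) (hξ : Measurable[m] (ξ t))
    (hζ : Measurable[m] (ζ (2 * t - 1))) : Measurable[m] (w (t + 1)) :=
  D.measurable_prox (D.γ_pos t ht).le hr (fun o => Data.run_r_mem (R.run o) R.start ht)
    (((measurable_call R.ℋ_meas hr hζ).const_smul _).add
      ((measurable_call R.𝒢_meas hwmd hξ).const_smul _)) fun o => (R.run o).w_succ t ht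

theorem measurable_iterates (n : ℕ) : Measurable[past ξ ζ n (2 * n)] (r (n + 1)) ∧
    Measurable[past ξ ζ n (2 * n)] (wag (n + 1)) ∧ Measurable[past ξ ζ n (2 * n)] (v (n + 1)) := by
  induction n with
  | zero =>
    have h1 : r (0 + 1) = fun _ => r₁ := funext fun o => (R.run o).r_one
    have h2 : wag (0 + 1) = fun _ => r₁ := funext fun o => (R.run o).wag_one
    have h3 : v (0 + 1) = fun _ => r₁ := funext fun o => (R.aux o).1
    rw [h1, h2, h3]
    exact ⟨measurable_const, measurable_const, measurable_const⟩
  | succ n ih =>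
    have hle : past ξ ζ n (2 * n) ≤ past ξ ζ (n + 1) (2 * (n + 1)) :=
      past_mono (by omega) (by omega)
    have hr := ih.1.mono hle le_rfl
    have hwag := ih.2.1.mono hle le_rfl
    have hv := ih.2.2.mono hle le_rfl
    have hwmd := measurable_wmd R (by omega) hr hwag
    have hξ : Measurable[past ξ ζ (n + 1) (2 * (n + 1))] (ξ (n + 1)) :=
      measurable_past_left (by omega)
    have hζ₁ : Measurable[past ξ ζ (n + 1) (2 * (n + 1))] (ζ (2 * (n + 1) - 1)) :=
      measurable_past_right (i := 2 * n) (by omega)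
    have hζ₂ : Measurable[past ξ ζ (n + 1) (2 * (n + 1))] (ζ (2 * (n + 1))) :=
      measurable_past_right (i := 2 * n + 1) (by omega)
    have hw := measurable_w D R (by omega) hr hwmd hξ hζ₁
    refine ⟨?_, ?_, ?_⟩
    · exact D.measurable_prox (D.γ_pos (n + 1) (by omega)).le hr
        (fun o => Data.run_r_mem (R.run o) R.start (by omega))
        (((measurable_call R.ℋ_meas hw hζ₂).const_smul _).add
          ((measurable_call R.𝒢_meas hwmd hξ).const_smul _))
        fun o => (R.run o).r_succ (n + 1) (by omega)
    · have h : wag (n + 1 + 1) =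
          fun o => (1 - α (n + 1)) • wag (n + 1) o + α (n + 1) • w (n + 1 + 1) o :=
        funext fun o => (R.run o).wag_succ (n + 1) (by omega)
      rw [h]
      exact (hwag.const_smul _).add (hw.const_smul _)
    · refine measurable_of_isProx D.norm_eq_zero D.μ_pos D.convex D.ω_diff D.ω_convex
        (convexOn_const 0 D.convex) hv
        (fun o => Data.aux_mem (R.aux o) R.start (by omega)) ?_
        fun o => (R.aux o).2 (n + 1) (by omega)
      have h1 := (measurable_call R.ℋ_meas hw hζ₂).sub
        (measurable_comp_of_continuousOn D.continuousOn_H hw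
          fun o => Data.run_w_mem (R.run o) (t := n + 1) (by omega))
      have h2 := (measurable_call R.𝒢_meas hwmd hξ).sub
        (measurable_comp_of_continuousOn D.G_cont hwmd
          fun o => D.run_wmd_mem (R.run o) R.start (by omega))
      exact ((h1.add h2).const_smul _).neg

theorem isCall_gradient {t : ℕ} (ht : 1 ≤ t) :
    IsCall P (past ξ ζ (t - 1) (2 * t - 2)) Z 𝒢 (∇ G) (wmd t) (ξ t) := by
  obtain ⟨n, rfl⟩ : ∃ n, t = n + 1 := ⟨t - 1, by omega⟩
  obtain ⟨hr, hwag, -⟩ := measurable_iterates D R n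
  have hwmd := measurable_wmd R (by omega) hr hwag
  have hmem : ∀ o, wmd (n + 1) o ∈ Z := fun o => D.run_wmd_mem (R.run o) R.start (by omega)
  exact ⟨past_le R.ξ_meas R.ζ_meas _ _, R.ξ_meas _ ht,
    indep_past R.ξ_meas R.ζ_meas R.indep (k := Sum.inl n) (by simp), R.𝒢_meas, hwmd,
    measurable_comp_of_continuousOn D.G_cont hwmd hmem, hmem⟩

theorem isCall_first {t : ℕ} (ht : 1 ≤ t) :
    IsCall P (past ξ ζ (t - 1) (2 * t - 2)) Z ℋ H (r t) (ζ (2 * t - 1)) := by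
  obtain ⟨n, rfl⟩ : ∃ n, t = n + 1 := ⟨t - 1, by omega⟩
  obtain ⟨hr, -, -⟩ := measurable_iterates D R n
  have hmem : ∀ o, r (n + 1) o ∈ Z := fun o => Data.run_r_mem (R.run o) R.start (by omega)
  exact ⟨past_le R.ξ_meas R.ζ_meas _ _, R.ζ_meas _ (by omega),
    indep_past R.ξ_meas R.ζ_meas R.indep (k := Sum.inr (2 * n)) (by simp; omega), R.ℋ_meas, hr,
    measurable_comp_of_continuousOn D.continuousOn_H hr hmem, hmem⟩

theorem measurable_w_past {t : ℕ} (ht : 1 ≤ t) :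
    Measurable[past ξ ζ t (2 * t - 1)] (w (t + 1)) := by
  obtain ⟨n, rfl⟩ : ∃ n, t = n + 1 := ⟨t - 1, by omega⟩
  obtain ⟨hr, hwag, -⟩ := measurable_iterates D R n
  have hle : past ξ ζ n (2 * n) ≤ past ξ ζ (n + 1) (2 * (n + 1) - 1) :=
    past_mono (by omega) (by omega)
  have hwmd := measurable_wmd R (by omega) hr hwag
  exact measurable_w D R (by omega) (hr.mono hle le_rfl) (hwmd.mono hle le_rfl)
    (measurable_past_left (by omega)) (measurable_past_right (i := 2 * n) (by omega))

/-- The point `w (t + 1)` has already used ξ_t and ζ_{2t-1}, hence the larger past; ζ_{2t} is still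
fresh. -/
theorem isCall_second {t : ℕ} (ht : 1 ≤ t) :
    IsCall P (past ξ ζ t (2 * t - 1)) Z ℋ H (w (t + 1)) (ζ (2 * t)) := by
  have hw := measurable_w_past D R ht
  have hmem : ∀ o, w (t + 1) o ∈ Z := fun o => Data.run_w_mem (R.run o) ht
  have hζ : ζ (2 * t) = ζ (2 * t - 1 + 1) := by congr 1; omega
  rw [hζ]
  exact ⟨past_le R.ξ_meas R.ζ_meas _ _, R.ζ_meas _ (by omega),
    indep_past R.ξ_meas R.ζ_meas R.indep (k := Sum.inr (2 * t - 1)) (by simp), R.ℋ_meas, hw,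
    measurable_comp_of_continuousOn D.continuousOn_H hw hmem, hmem⟩

theorem measurable_r_past {t : ℕ} (ht : 1 ≤ t) :
    Measurable[past ξ ζ (t - 1) (2 * t - 2)] (r t) := by
  obtain ⟨n, rfl⟩ : ∃ n, t = n + 1 := ⟨t - 1, by omega⟩
  exact (measurable_iterates D R n).1

theorem measurable_v_past {t : ℕ} (ht : 1 ≤ t) :
    Measurable[past ξ ζ (t - 1) (2 * t - 2)] (v t) := by
  obtain ⟨n, rfl⟩ : ∃ n, t = n + 1 := ⟨t - 1, by omega⟩
  exact (measurable_iterates D R n).2.2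

/-- The direction paired with the error of the second call of `ℋ` is determined by the past. -/
theorem measurable_dir_second {t : ℕ} (ht : 1 ≤ t) :
    Measurable[past ξ ζ t (2 * t - 1)] fun o => (α t / Gam α t) • (v t o - w (t + 1) o) :=
  (((measurable_v_past D R ht).mono (past_mono (by omega) (by omega)) le_rfl).sub
    (measurable_w_past D R ht)).const_smul _

/-- The direction paired with the error of `𝒢` is determined by the past. -/
theorem measurable_dir_gradient {t : ℕ} (ht : 1 ≤ t) :
    Measurable[past ξ ζ (t - 1) (2 * t - 2)] fun o => (α t / Gam α t) • (v t o - r t o) :=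
  ((measurable_v_past D R ht).sub (measurable_r_past D R ht)).const_smul _

theorem measurable_gap {t : ℕ} (ht : 1 ≤ t) : Measurable fun o => gap Z G H J (wag t o) := by
  obtain ⟨n, rfl⟩ : ∃ n, t = n + 1 := ⟨t - 1, by omega⟩
  exact measurable_comp_of_lowerSemicontinuousOn D.lowerSemicontinuousOn_gap
    ((measurable_iterates D R n).2.1.mono (past_le R.ξ_meas R.ζ_meas _ _) le_rfl)
    fun o => D.run_wag_mem (R.run o) R.start ht

omit [BorelSpace E] in
/-- The bound of the gap, with the directions of the pairings weighted. -/
theorem gap_le {t : ℕ} (ht : 1 ≤ t) (o : Ω) :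
    gap Z G H J (wag (t + 1) o) ≤ 2 * α t / γ t * ΩZ ^ 2 + Gam α t *
      (5 / 2 * ∑ i ∈ Icc 1 t, α i * γ i / (μ * Gam α i) *
          dualNorm N (callErr ℋ H (w (i + 1) o) (ζ (2 * i) o)) ^ 2 +
        3 / 2 * ∑ i ∈ Icc 1 t, α i * γ i / (μ * Gam α i) *
          dualNorm N (callErr ℋ H (r i o) (ζ (2 * i - 1) o)) ^ 2 +
        (1 + 1 / (2 * (1 - q))) * ∑ i ∈ Icc 1 t, α i * γ i / (μ * Gam α i) *
          dualNorm N (callErr 𝒢 (∇ G) (wmd i o) (ξ i o)) ^ 2 +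
        ∑ i ∈ Icc 1 t, ⟪callErr ℋ H (w (i + 1) o) (ζ (2 * i) o),
          (α i / Gam α i) • (v i o - w (i + 1) o)⟫ +
        ∑ i ∈ Icc 1 t, ⟪callErr 𝒢 (∇ G) (wmd i o) (ξ i o),
          (α i / Gam α i) • (v i o - r i o)⟫) := by
  refine (D.gap_run_le (R.run o) R.start (R.aux o) ht).trans (le_of_eq ?_)
  congr 2
  rw [mul_sum, mul_sum, mul_sum, ← sum_add_distrib, ← sum_add_distrib, ← sum_add_distrib,
    ← sum_add_distrib]
  refine sum_congr rfl fun i _ => ?_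
  rw [real_inner_smul_right, real_inner_smul_right, Data.sqErr]
  ring

variable [IsProbabilityMeasure P]

/-- The bound of the expected gap. -/
theorem integral_gap_le (h𝒢 : Unbiased P Z 𝒢 (∇ G) ξ) (hℋ : Unbiased P Z ℋ H ζ)
    (hvG : VarianceBound P N Z 𝒢 (∇ G) ξ σG) (hvH : VarianceBound P N Z ℋ H ζ σH)
    {t : ℕ} (ht : 1 ≤ t) :
    Integrable (fun o => gap Z G H J (wag (t + 1) o)) P ∧
      ∫ o, gap Z G H J (wag (t + 1) o) ∂P ≤ Q0 μ q σG σH ΩZ α γ t := by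
  have hN := D.norm_eq_zero
  have hq : 0 < 1 - q := sub_pos.2 D.q_lt
  have h₂ : ∀ i ∈ Icc 1 t, _ := fun i hi =>
    (isCall_second D R (mem_Icc.1 hi).1).integrable_sq hN
      (hvH (2 * i) (by have := (mem_Icc.1 hi).1; omega))
  have h₁ : ∀ i ∈ Icc 1 t, _ := fun i hi =>
    (isCall_first D R (mem_Icc.1 hi).1).integrable_sq hN
      (hvH (2 * i - 1) (by have := (mem_Icc.1 hi).1; omega))
  have h₃ : ∀ i ∈ Icc 1 t, _ := fun i hi =>
    (isCall_gradient D R (mem_Icc.1 hi).1).integrable_sq hN (hvG i (mem_Icc.1 hi).1)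
  have i₂ : ∀ i ∈ Icc 1 t, _ := fun i hi =>
    (isCall_second D R (mem_Icc.1 hi).1).integrable_inner hN (h₂ i hi).1
      (measurable_dir_second D R (mem_Icc.1 hi).1) fun o =>
        D.seminorm_dir_le (mem_Icc.1 hi).1 (Data.run_w_mem (R.run o) (mem_Icc.1 hi).1)
          (Data.aux_mem (R.aux o) R.start (mem_Icc.1 hi).1)
  have i₃ : ∀ i ∈ Icc 1 t, _ := fun i hi =>
    (isCall_gradient D R (mem_Icc.1 hi).1).integrable_inner hN (h₃ i hi).1
      (measurable_dir_gradient D R (mem_Icc.1 hi).1) fun o =>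
        D.seminorm_dir_le (mem_Icc.1 hi).1 (Data.run_r_mem (R.run o) R.start (mem_Icc.1 hi).1)
          (Data.aux_mem (R.aux o) R.start (mem_Icc.1 hi).1)
  have z₂ : ∀ i ∈ Icc 1 t, _ := fun i hi =>
    (isCall_second D R (mem_Icc.1 hi).1).integral_inner
      (measurable_dir_second D R (mem_Icc.1 hi).1)
      (fun z hz d => integral_inner_callErr_const
        (hℋ (2 * i) (by have := (mem_Icc.1 hi).1; omega) z hz).1
        (hℋ (2 * i) (by have := (mem_Icc.1 hi).1; omega) z hz).2 d) (i₂ i hi)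
  have z₃ : ∀ i ∈ Icc 1 t, _ := fun i hi =>
    (isCall_gradient D R (mem_Icc.1 hi).1).integral_inner
      (measurable_dir_gradient D R (mem_Icc.1 hi).1)
      (fun z hz d => integral_inner_callErr_const (h𝒢 i (mem_Icc.1 hi).1 z hz).1
        (h𝒢 i (mem_Icc.1 hi).1 z hz).2 d) (i₃ i hi)
  have c₂ := integrable_finsetSum _ fun i hi => (h₂ i hi).1.const_mul (α i * γ i / (μ * Gam α i))
  have c₁ := integrable_finsetSum _ fun i hi => (h₁ i hi).1.const_mul (α i * γ i / (μ * Gam α i))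
  have c₃ := integrable_finsetSum _ fun i hi => (h₃ i hi).1.const_mul (α i * γ i / (μ * Gam α i))
  obtain ⟨hB, hBeq⟩ := integral_affine_comb (2 * α t / γ t * ΩZ ^ 2) (Gam α t) (5 / 2) (3 / 2)
    (1 + 1 / (2 * (1 - q))) c₂ c₁ c₃ (integrable_finsetSum _ i₂) (integrable_finsetSum _ i₃)
  have hle := fun o => gap_le D R ht o
  have hnn : ∀ o, 0 ≤ gap Z G H J (wag (t + 1) o) := fun o =>
    D.gap_nonneg (D.run_wag_mem (R.run o) R.start (by omega))
  have hint : Integrable (fun o => gap Z G H J (wag (t + 1) o)) P :=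
    hB.mono' (measurable_gap D R (by omega)).aestronglyMeasurable
      (Filter.Eventually.of_forall fun o => by
        rw [Real.norm_eq_abs, abs_of_nonneg (hnn o)]; exact hle o)
  refine ⟨hint, (integral_mono hint hB hle).trans ?_⟩
  have hsum : ∀ (f : ℕ → Ω → ℝ) (σ : ℝ),
      (∀ i ∈ Icc 1 t, Integrable (f i) P ∧ ∫ o, f i o ∂P ≤ σ ^ 2) →
      ∫ o, ∑ i ∈ Icc 1 t, α i * γ i / (μ * Gam α i) * f i o ∂P ≤
        σ ^ 2 * ∑ i ∈ Icc 1 t, α i * γ i / (μ * Gam α i) := fun f σ hf => by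
    rw [integral_finsetSum _ fun i hi => (hf i hi).1.const_mul _, mul_sum]
    refine sum_le_sum fun i hi => ?_
    rw [integral_const_mul, mul_comm]
    exact mul_le_mul_of_nonneg_right (hf i hi).2 (D.weight_nonneg i (mem_Icc.1 hi).1)
  have e₂ := hsum _ σH h₂
  have e₁ := hsum _ σH h₁
  have e₃ := mul_le_mul_of_nonneg_left (hsum _ σG h₃)
    (show 0 ≤ 1 + 1 / (2 * (1 - q)) by positivity)
  have e₄ := (integral_finsetSum _ i₂).trans (sum_eq_zero z₂)
  have e₅ := (integral_finsetSum _ i₃).trans (sum_eq_zero z₃)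
  have hΓ := (D.Gam_pos t).le
  rw [hBeq, e₄, e₅]
  unfold Q0 noiseTerm
  -- Here 5/2 + 3/2 produces the coefficient 4 of σ_H².
  have h5 := mul_le_mul_of_nonneg_left
    (add_le_add (add_le_add (mul_le_mul_of_nonneg_left e₂ (by norm_num : (0 : ℝ) ≤ 5 / 2))
      (mul_le_mul_of_nonneg_left e₁ (by norm_num : (0 : ℝ) ≤ 3 / 2))) e₃) hΓ
  rw [add_zero, add_zero]
  refine (add_le_add_right h5 _).trans (le_of_eq ?_)
  ring

/-- The large deviation bound of the gap. -/
theorem measureReal_gap_le (h𝒢 : Unbiased P Z 𝒢 (∇ G) ξ) (hℋ : Unbiased P Z ℋ H ζ)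
    (hσG : 0 ≤ σG) (hσH : 0 ≤ σH) (hlG : LightTail P N Z 𝒢 (∇ G) ξ σG)
    (hlH : LightTail P N Z ℋ H ζ σH) {l : ℝ} (hl : 0 < l) {t : ℕ} (ht : 1 ≤ t) :
    P.real {o | Q0 μ q σG σH ΩZ α γ t + l * Q1 μ q σG σH ΩZ α γ t
        < gap Z G H J (wag (t + 1) o)} ≤ 2 * Real.exp (-l ^ 2 / 3) + 3 * Real.exp (-l) := by
  have hN := D.norm_eq_zero
  have hq : 0 < 1 - q := sub_pos.2 D.q_lt
  have hμ := D.μ_pos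
  have hΓ := D.Gam_pos t
  set C := ∑ i ∈ Icc 1 t, α i * γ i / (μ * Gam α i) with hC
  set T := ΩZ * Real.sqrt (2 / μ * ∑ i ∈ Icc 1 t, (α i / Gam α i) ^ 2) with hT
  have hsqrt : ∀ σ : ℝ, 0 ≤ σ → Real.sqrt (∑ i ∈ Icc 1 t,
      (σ * (α i / Gam α i * (ΩZ * Real.sqrt (2 / μ)))) ^ 2) = σ * T := fun σ hσ => by
    have h1 : ∑ i ∈ Icc 1 t, (σ * (α i / Gam α i * (ΩZ * Real.sqrt (2 / μ)))) ^ 2 =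
        (σ * ΩZ) ^ 2 * (2 / μ * ∑ i ∈ Icc 1 t, (α i / Gam α i) ^ 2) := by
      rw [mul_sum, mul_sum]
      refine sum_congr rfl fun i _ => ?_
      simp only [mul_pow, Real.sq_sqrt (show 0 ≤ 2 / μ by positivity)]
      ring
    rw [h1, Real.sqrt_mul (sq_nonneg _), Real.sqrt_sq (mul_nonneg hσ D.ΩZ_nonneg), hT, mul_assoc]
  -- The three sums of squares cost exp(-l) each, and the two martingale sums `p₄`, `p₅` cost
  -- exp(-l²/3) each.
  have p₁ := measureReal_sum_sq_lt_le hN (fun i hi => isCall_second D R hi)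
    (fun i hi => hlH (2 * i) (by omega)) (D.weight_nonneg) t l
  have p₂ := measureReal_sum_sq_lt_le hN (fun i hi => isCall_first D R hi)
    (fun i hi => hlH (2 * i - 1) (by omega)) (D.weight_nonneg) t l
  have p₃ := measureReal_sum_sq_lt_le hN (fun i hi => isCall_gradient D R hi)
    (fun i hi => hlG i hi) (D.weight_nonneg) t l
  have p₄ := measureReal_sum_inner_lt_le hN hσH (fun i hi => isCall_second D R hi)
    (fun i _ => past_mono (by omega) (by omega))
    (fun i hi => by
      have h1 : ζ (2 * i) = ζ (2 * i - 1 + 1) := by congr 1; omega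
      rw [h1]
      exact measurable_past_right (by omega))
    (fun i hi => measurable_dir_second D R hi)
    (fun i hi o => D.seminorm_dir_le hi (Data.run_w_mem (R.run o) hi)
      (Data.aux_mem (R.aux o) R.start hi))
    (fun i hi z hz d => integral_inner_callErr_const (hℋ (2 * i) (by omega) z hz).1
      (hℋ (2 * i) (by omega) z hz).2 d)
    (fun i hi => hlH (2 * i) (by omega)) t hl
  have p₅ := measureReal_sum_inner_lt_le hN hσG (fun i hi => isCall_gradient D R hi)
    (fun i _ => past_mono (by omega) (by omega))
    (fun i hi => by
      have h1 : ξ i = ξ (i - 1 + 1) := by congr 1; omega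
      rw [h1]
      exact measurable_past_left (by omega))
    (fun i hi => measurable_dir_gradient D R hi)
    (fun i hi o => D.seminorm_dir_le hi (Data.run_r_mem (R.run o) R.start hi)
      (Data.aux_mem (R.aux o) R.start hi))
    (fun i hi z hz d => integral_inner_callErr_const (h𝒢 i hi z hz).1 (h𝒢 i hi z hz).2 d)
    (fun i hi => hlG i hi) t hl
  rw [hsqrt _ hσH] at p₄
  rw [hsqrt _ hσG] at p₅
  rw [← hC] at p₁ p₂ p₃
  refine (measureReal_mono (fun o ho => ?_) (by finiteness)).trans
    ((measureReal_union_le _ _).trans (add_le_add ((measureReal_union_le _ _).trans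
      (add_le_add ((measureReal_union_le _ _).trans (add_le_add ((measureReal_union_le _ _).trans
        (add_le_add p₁ p₂)) p₃)) p₄)) p₅) |>.trans (le_of_eq (by ring)))
  -- Off the five events the pathwise bound applies: the factor 1 + l on the squares puts one noise
  -- term into `Q0` and l of them into `l * Q1`.
  by_contra hno
  simp only [Set.mem_union, Set.mem_ofPred_eq, not_or, not_lt] at hno ho
  obtain ⟨⟨⟨⟨b₁, b₂⟩, b₃⟩, b₄⟩, b₅⟩ := hno
  have b₃' := mul_le_mul_of_nonneg_left b₃ (show 0 ≤ 1 + 1 / (2 * (1 - q)) by positivity)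
  have b := mul_le_mul_of_nonneg_left
    (add_le_add (add_le_add (add_le_add (add_le_add
      (mul_le_mul_of_nonneg_left b₁ (by norm_num : (0 : ℝ) ≤ 5 / 2))
      (mul_le_mul_of_nonneg_left b₂ (by norm_num : (0 : ℝ) ≤ 3 / 2))) b₃') b₄) b₅) hΓ.le
  have hfin := ((gap_le D R ht o).trans (add_le_add_right b _))
  refine absurd ho (not_lt.2 (hfin.trans (le_of_eq ?_)))
  unfold Q0 Q1 noiseTerm
  rw [mul_assoc (Gam α t * (σG + σH)), ← hT, ← hC]
  ring

end RandomRun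

end RandomRun

end StochAMP

/-! ### The main theorem. -/

open StochAMP in
theorem mainTheorem5
    {E : Type*} [NormedAddCommGroup E] [InnerProductSpace ℝ E] [FiniteDimensional ℝ E]
    [CompleteSpace E] [MeasurableSpace E] [BorelSpace E]
    -- the norm, not necessarily the one induced by the inner product
    (N : Seminorm ℝ E) (hN : ∀ x, N x = 0 → x = 0)
    -- the feasible set
    (Z : Set E) (hZne : Z.Nonempty) (hZclosed : IsClosed Z) (hZconv : Convex ℝ Z)
    -- the smooth component
    (G : E → ℝ) (LG : ℝ) (hLG : 0 ≤ LG)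
    (hGdiff : ∀ z ∈ Z, DifferentiableAt ℝ G z) (hGcont : ContinuousOn (∇ G) Z)
    (hG : ∀ x ∈ Z, ∀ v ∈ Z, 0 ≤ G x - G v - ⟪∇ G v, x - v⟫ ∧
      G x - G v - ⟪∇ G v, x - v⟫ ≤ LG / 2 * N (x - v) ^ 2)
    -- the monotone Lipschitz component
    (H : E → E) (LH : ℝ) (hLH : 0 ≤ LH)
    (hHmono : ∀ x ∈ Z, ∀ v ∈ Z, 0 ≤ ⟪H x - H v, x - v⟫)
    (hHlip : ∀ x ∈ Z, ∀ v ∈ Z, dualNorm N (H x - H v) ≤ LH * N (x - v))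
    -- the simple convex component
    (J : E → ℝ) (hJconv : ConvexOn ℝ Z J) (hJlsc : LowerSemicontinuousOn J Z)
    -- the distance generating function
    (ω : E → ℝ) (μ : ℝ) (hμ : 0 < μ)
    (hωdiff : ∀ z ∈ Z, DifferentiableAt ℝ ω z) (hω : StronglyConvexOn N μ Z ω)
    -- the bound on the prox-function
    (ΩZ : ℝ) (hΩZ : 0 ≤ ΩZ) (hV : ∀ z₁ ∈ Z, ∀ z₂ ∈ Z, bregman ω z₁ z₂ ≤ ΩZ ^ 2)
    -- the step sizes
    (α γ : ℕ → ℝ) (q : ℝ) (hq0 : 0 < q) (hq1 : q < 1)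
    (hα1 : α 1 = 1) (hα : ∀ t, 2 ≤ t → 0 ≤ α t ∧ α t < 1)
    (hγ : ∀ t, 1 ≤ t → 0 < γ t)
    (hstep : ∀ t, 1 ≤ t → 0 ≤ q * μ - LG * α t * γ t - 3 * LH ^ 2 * γ t ^ 2 / μ)
    (hmono : ∀ t, 1 ≤ t →
      α t / (Gam α t * γ t) ≤ α (t + 1) / (Gam α (t + 1) * γ (t + 1)))
    -- the stochastic oracles and their independent samples
    {Ω : Type*} [MeasurableSpace Ω] (P : Measure Ω) [IsProbabilityMeasure P]
    {Ξ : Type*} [MeasurableSpace Ξ] (ξ ζ : ℕ → Ω → Ξ)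
    (hξ : ∀ i, 1 ≤ i → Measurable (ξ i)) (hζ : ∀ i, 1 ≤ i → Measurable (ζ i))
    (hindep : iIndepFun (Sum.elim (fun i : ℕ => ξ (i + 1)) (fun i : ℕ => ζ (i + 1))) P)
    (𝒢 ℋ : E → Ξ → E)
    (h𝒢meas : Measurable (Function.uncurry 𝒢)) (hℋmeas : Measurable (Function.uncurry ℋ))
    (h𝒢 : Unbiased P Z 𝒢 (∇ G) ξ) (hℋ : Unbiased P Z ℋ H ζ)
    (σG σH : ℝ) (hσG : 0 ≤ σG) (hσH : 0 ≤ σH)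
    -- the iterates of the stochastic method
    (r₁ : E) (hr₁ : r₁ ∈ Z) (r w wag wmd : ℕ → Ω → E)
    (hrun : ∀ o : Ω, IsRun Z ω J 𝒢 ℋ α γ r₁ (fun i => ξ i o) (fun i => ζ i o)
      (fun t => r t o) (fun t => w t o) (fun t => wag t o) (fun t => wmd t o)) :
    -- the gap function is finite on the feasible set
    (∀ x ∈ Z, BddAbove (gapQ G H J x '' Z)) ∧
    -- (a)
    (VarianceBound P N Z 𝒢 (∇ G) ξ σG → VarianceBound P N Z ℋ H ζ σH →
      ∀ t, 1 ≤ t →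
        Integrable (fun o => gap Z G H J (wag (t + 1) o)) P ∧
          ∫ o, gap Z G H J (wag (t + 1) o) ∂P ≤ Q0 μ q σG σH ΩZ α γ t) ∧
    -- (b)
    (LightTail P N Z 𝒢 (∇ G) ξ σG → LightTail P N Z ℋ H ζ σH →
      ∀ l : ℝ, 0 < l → ∀ t, 1 ≤ t →
        P.real {o | Q0 μ q σG σH ΩZ α γ t + l * Q1 μ q σG σH ΩZ α γ t
            < gap Z G H J (wag (t + 1) o)}
          ≤ 2 * Real.exp (-l ^ 2 / 3) + 3 * Real.exp (-l)) := by
  have D : Data N Z G LG H LH J ω μ ΩZ α γ q :=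
    ⟨hN, hZne, hZclosed, hZconv, hLG, hGdiff, hGcont, hG, hLH, hHmono, hHlip, hJconv, hJlsc, hμ,
      hωdiff, hω, hΩZ, hV, hq0, hq1, hα1, hα, hγ, hstep, hmono⟩
  obtain ⟨v, hv⟩ := D.exists_aux r₁ fun t o => callErr ℋ H (w (t + 1) o) (ζ (2 * t) o) +
    callErr 𝒢 (∇ G) (wmd t o) (ξ t o)
  have R : RandomRun Z G H J ω α γ P ξ ζ 𝒢 ℋ r₁ r w wag wmd v :=
    ⟨hr₁, hξ, hζ, hindep, h𝒢meas, hℋmeas, hrun, hv⟩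
  exact ⟨fun x hx => D.bddAbove_gapQ hx,
    fun hvG hvH t ht => R.integral_gap_le D h𝒢 hℋ hvG hvH ht,
    fun hlG hlH l hl t ht => R.measureReal_gap_le D h𝒢 hℋ hσG hσH hlG hlH hl ht⟩
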